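/- There is an absolute constant $C>0$ with the following property. Let $G$ be a finite two-player extensive-form game (general-sum, possibly with chance nodes) with perfect recall, let $N$ be the number of nodes of its game tree, and suppose that all payoffs are bounded in absolute value by $M$. For a player $i$, the sequence of $i$ at a node $h$ is the list of information sets of $i$ visited, together with the actions taken there, on the path from the root to $h$; a terminal sequence of $i$ is the sequence of $i$ at some terminal node $z$. A terminal sequence is in the support of a pure strategy of $i$ if that strategy chooses every action in it. Let $D$ be the maximum, over both players and all their pure strategies, of the number of terminal sequences in the support of the pure strategy. Then for every $\varepsilon>0$, $G$ has an $\varepsilon$-Nash equilibrium (a profile $(\sigma_1,\sigma_2)$ of behavior strategies in which neither player can gain more than $\varepsilon$ by deviating) in which each player mixes over at most $$\max\Bigl\{1,\; C\,\frac{M^2D^2}{\varepsilon^2}\,\log N\Bigr\}$$ pure strategies, that is, each $\sigma_i$ gives every node the same reach probability as some mixed strategy of player $i$ whose support has at most that many pure strategies. -/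

import Mathlib

/-- The actions available at the node `h` of a tree of histories `H`. A history is the list of the
actions taken so far, the most recent one first: the child of `h` along `a` is `a :: h`. -/
noncomputable def childActions {Act : Type*} (H : Finset (List Act)) (h : List Act) : Finset Act :=
  H.preimage (fun a => a :: h)
    (Function.Injective.injOn fun _ _ hab => (List.cons.inj hab).1)

theorem mem_childActions {Act : Type*} {H : Finset (List Act)} {h : List Act} {a : Act} :
    a ∈ childActions H h ↔ a :: h ∈ H :=
  Finset.mem_preimage

/-- A finite extensive-form game with player set `ι`, actions in `Act`, and information sets
labelled by elements of `Info`. The values of `turn`, `info`, `chance` and `utility` matter only at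
the nodes where they make sense. -/
structure ExtensiveGame (ι Act Info : Type*) where
  /-- the nodes (histories) of the game tree -/
  nodes : Finset (List Act)
  root_mem : [] ∈ nodes
  parent_mem : ∀ (a : Act) (h : List Act), a :: h ∈ nodes → h ∈ nodes
  /-- who acts at a non-terminal node: `some i` is player `i`, `none` is nature -/
  turn : List Act → Option ι
  /-- two decision nodes of a player lie in the same information set iff their labels agree -/
  info : List Act → Info
  info_actions : ∀ (i : ι) (h h' : List Act), h ∈ nodes → h' ∈ nodes →
    (childActions nodes h).Nonempty → (childActions nodes h').Nonempty →
    turn h = some i → turn h' = some i → info h = info h' →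
    childActions nodes h = childActions nodes h'
  /-- nature's distribution over the actions at each node where nature acts -/
  chance : List Act → Act → ℝ
  chance_nonneg : ∀ h ∈ nodes, (childActions nodes h).Nonempty → turn h = none →
    ∀ a ∈ childActions nodes h, 0 ≤ chance h a
  chance_sum : ∀ h ∈ nodes, (childActions nodes h).Nonempty → turn h = none →
    ∑ a ∈ childActions nodes h, chance h a = 1
  /-- the payoff of each player at each terminal node -/
  utility : ι → List Act → ℝ

namespace ExtensiveGame

variable {ι Act Info : Type*}

/-- The actions available at a node. -/
noncomputable def actions (G : ExtensiveGame ι Act Info) (h : List Act) : Finset Act :=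
  childActions G.nodes h

open Classical in
/-- The terminal nodes (leaves) of the game tree. -/
noncomputable def terminals (G : ExtensiveGame ι Act Info) : Finset (List Act) :=
  G.nodes.filter (fun z => ¬ (G.actions z).Nonempty)

/-- `h` is a decision node of player `i`. -/
def IsDecision (G : ExtensiveGame ι Act Info) (i : ι) (h : List Act) : Prop :=
  h ∈ G.nodes ∧ (G.actions h).Nonempty ∧ G.turn h = some i

/-- The information sets of player `i`. -/
def InfoSet (G : ExtensiveGame ι Act Info) (i : ι) : Type _ :=
  {I : Info // ∃ h, G.IsDecision i h ∧ G.info h = I}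

/-- The information set of player `i` that contains a given decision node. -/
def infoAt (G : ExtensiveGame ι Act Info) {i : ι} (h : List Act) (hh : G.IsDecision i h) :
    G.InfoSet i :=
  ⟨G.info h, h, hh, rfl⟩

open Classical in
/-- The sequence of player `i` at `h`: the information sets of `i` visited before `h`, with the
actions taken there, most recent first. -/
noncomputable def sequence (G : ExtensiveGame ι Act Info) (i : ι) :
    List Act → List (Info × Act)
  | [] => []
  | a :: h => if G.turn h = some i then (G.info h, a) :: G.sequence i h else G.sequence i h

/-- Perfect recall: any two nodes in the same information set of a player carry the same sequence
of that player. -/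
def PerfectRecall (G : ExtensiveGame ι Act Info) : Prop :=
  ∀ (i : ι) (h h' : List Act), G.IsDecision i h → G.IsDecision i h' → G.info h = G.info h' →
    G.sequence i h = G.sequence i h'

/-- A behavior strategy of player `i`: at each information set of `i`, a distribution over the
actions available there. -/
structure BehaviorStrategy (G : ExtensiveGame ι Act Info) (i : ι) where
  prob : G.InfoSet i → Act → ℝ
  prob_nonneg : ∀ (h : List Act) (hh : G.IsDecision i h), ∀ a ∈ G.actions h,
    0 ≤ prob (G.infoAt h hh) a
  prob_sum : ∀ (h : List Act) (hh : G.IsDecision i h),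
    ∑ a ∈ G.actions h, prob (G.infoAt h hh) a = 1

/-- A pure strategy of player `i`: an available action at each information set of `i`. -/
structure PureStrategy (G : ExtensiveGame ι Act Info) (i : ι) where
  choice : G.InfoSet i → Act
  choice_mem : ∀ (h : List Act) (hh : G.IsDecision i h), choice (G.infoAt h hh) ∈ G.actions h

open Classical in
/-- A pure strategy as a (deterministic) behavior strategy. -/
noncomputable def PureStrategy.toBehavior {G : ExtensiveGame ι Act Info} {i : ι}
    (p : G.PureStrategy i) : G.BehaviorStrategy i where
  prob I a := if p.choice I = a then 1 else 0
  prob_nonneg h hh a _ := by split_ifs <;> norm_num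
  prob_sum h hh := by rw [Finset.sum_ite_eq, if_pos (p.choice_mem h hh)]

/-- A mixed strategy of player `i`: a distribution over the pure strategies of `i`. -/
structure MixedStrategy (G : ExtensiveGame ι Act Info) (i : ι) where
  weight : G.PureStrategy i →₀ ℝ
  weight_nonneg : ∀ p, 0 ≤ weight p
  weight_sum : ∑ p ∈ weight.support, weight p = 1

open Classical in
/-- The reach probability of a node under a strategy of player `i`, when nature and all other
players always choose the actions that lead to the node. -/
noncomputable def BehaviorStrategy.reach {G : ExtensiveGame ι Act Info} {i : ι}
    (s : G.BehaviorStrategy i) : List Act → ℝ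
  | [] => 1
  | a :: h => s.reach h * if hh : G.IsDecision i h then s.prob (G.infoAt h hh) a else 1

/-- The reach probability of a node under a mixed strategy. -/
noncomputable def MixedStrategy.reach {G : ExtensiveGame ι Act Info} {i : ι}
    (m : G.MixedStrategy i) (h : List Act) : ℝ :=
  ∑ p ∈ m.weight.support, m.weight p * p.toBehavior.reach h

/-- A behavior strategy and a mixed strategy are realization equivalent: every node has the same
reach probability under both. -/
def RealizationEquivalent (G : ExtensiveGame ι Act Info) {i : ι}
    (s : G.BehaviorStrategy i) (m : G.MixedStrategy i) : Prop :=
  ∀ h ∈ G.nodes, s.reach h = m.reach h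

open Classical in
/-- The probability that nature's choices lead to a node, when all players choose the actions that
lead to it. -/
noncomputable def chanceReach (G : ExtensiveGame ι Act Info) : List Act → ℝ
  | [] => 1
  | a :: h => G.chanceReach h * if G.turn h = none then G.chance h a else 1

/-- The value (expected payoff) of a strategy profile for player `i`. -/
noncomputable def value [Fintype ι] (G : ExtensiveGame ι Act Info)
    (s : ∀ j, G.BehaviorStrategy j) (i : ι) : ℝ :=
  ∑ z ∈ G.terminals, (G.chanceReach z * ∏ j, (s j).reach z) * G.utility i z

/-- `s` is an `ε`-Nash equilibrium: no player can gain more than `ε` by deviating to another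
strategy. -/
def IsNash [Fintype ι] [DecidableEq ι] (G : ExtensiveGame ι Act Info) (ε : ℝ)
    (s : ∀ j, G.BehaviorStrategy j) : Prop :=
  ∀ (i : ι) (t : G.BehaviorStrategy i), G.value (Function.update s i t) i - ε ≤ G.value s i

/-- The terminal sequences (sequences of player `i` at terminal nodes) in the support of a pure
strategy of player `i`. -/
def supportSequences (G : ExtensiveGame ι Act Info) {i : ι} (p : G.PureStrategy i) :
    Set (List (Info × Act)) :=
  G.sequence i '' {z | z ∈ G.terminals ∧ 0 < p.toBehavior.reach z}

end ExtensiveGame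

/-!
A Nash equilibrium of the normal form is sparsified by sampling pure strategies from it, as in the
argument of Lipton, Markakis and Mehta for bimatrix games. If `xᵢ` is the exact equilibrium strategy
of player `i` and `mᵢ` is the uniform distribution on `k` pure strategies from its support, it
suffices that every pure strategy `p` of player `i` has nearly the same payoff against `mⱼ` as
against `xⱼ`: the support of `mᵢ` consists of best responses to `xⱼ`, so `mᵢ` is then nearly a best
response to `mⱼ` (`ExtensiveGame.PerfectRecall.exists_isNash_sparse`).

A union bound over the pure strategies `p` would cost the logarithm of their number, which can be
exponential in the size `N` of the tree. Instead the payoff of `p` is split over the terminal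
sequences in its support (`ExtensiveGame.payoff_pure_eq_sum_seqPayoff`). There are at most `D` of
these, each contributes at most `M` in absolute value because chance and the opponent put total mass
at most one on the leaves with a given sequence
(`ExtensiveGame.PerfectRecall.sum_chanceReach_mul_reach_le_one`), and the contribution does not
depend on `p`. So only the at most `N` terminal sequences have to be controlled, each up to an error
`ε / (2 D)`, and `k` of order `M² D² log N / ε²` suffices (`exists_sample_abs_sub_le`, a Hoeffding
bound with the sample points chosen greedily by conditional expectations).

The passage between behavior and mixed strategies is Kuhn's theorem in both directions
(`ExtensiveGame.PerfectRecall.exists_realizationEquivalent`,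
`ExtensiveGame.PerfectRecall.exists_weights_reach`). The existence of an equilibrium of the normal
form (`exists_bimatrix_equilibrium`) comes from Scarf's combinatorial lemma
(`Scarf.exists_dominated_by_colours`), a parity argument in the style of Sperner's lemma that needs
no triangulation: grid points of the simplex are coloured by a best response, and a set that is
dominated on its own colours shrinks, as the mesh is refined, to a point all of whose support
consists of best responses (`exists_support_subset_argmax`).
-/

/-! ### Scarf's lemma -/

namespace Scarf

section Parity

variable {X I α : Type*} [LinearOrder α]

/-- A finite set `S` is dominated, for a family of preference scales `f i`, if no point `y` is
strictly above the minimum of `S` on all scales at once. -/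
def IsDominated (f : I → X → α) (S : Finset X) : Prop :=
  ∀ y, ∃ i, ∀ x ∈ S, f i y ≤ f i x

theorem IsDominated.mono {f : I → X → α} {S T : Finset X} (hT : IsDominated f T) (h : S ⊆ T) :
    IsDominated f S := fun y =>
  let ⟨i, hi⟩ := hT y
  ⟨i, fun x hx => hi x (h hx)⟩

theorem exists_minimizers (f : I → X → α) {S : Finset X} (hS : S.Nonempty) :
    ∃ m : I → X, ∀ i, m i ∈ S ∧ ∀ x ∈ S, f i (m i) ≤ f i x := by
  choose m hm using fun i => S.exists_min_image (f i) hS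
  exact ⟨m, hm⟩

variable [Fintype I] [DecidableEq X]

/-- Every point of a dominated set is its minimum on some scale. -/
theorem IsDominated.image_eq {f : I → X → α} (hf : ∀ i, Function.Injective (f i))
    {S : Finset X} (hS : IsDominated f S) {m : I → X}
    (hm : ∀ i, m i ∈ S ∧ ∀ x ∈ S, f i (m i) ≤ f i x) :
    Finset.univ.image m = S := by
  ext y
  simp only [Finset.mem_image, Finset.mem_univ, true_and]
  constructor
  · rintro ⟨i, rfl⟩
    exact (hm i).1
  · intro hy
    obtain ⟨i, hi⟩ := hS y
    exact ⟨i, hf i (le_antisymm ((hm i).2 y hy) (hi _ (hm i).1))⟩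

variable [DecidableEq I]

/-- If a dominated set `τ` has one point less than there are scales, then two scales have the same
minimizer in `τ`. A point `x` completes `τ` to a dominated set of full size exactly when, for `k`
one of these two scales, `x` is the highest point on scale `k` among the points above the minimum
of `τ` on all other scales. -/
theorem exists_pair_of_isDominated {f : I → X → α} (hf : ∀ i, Function.Injective (f i))
    {τ : Finset X} (hτ : IsDominated f τ)
    (hcard : τ.card + 1 = Fintype.card I) {m : I → X}
    (hm : ∀ i, m i ∈ τ ∧ ∀ x ∈ τ, f i (m i) ≤ f i x) :
    ∃ i j, i ≠ j ∧ ∀ x, (x ∉ τ ∧ IsDominated f (insert x τ)) ↔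
      ∃ k, (k = i ∨ k = j) ∧ (∀ l, l ≠ k → f l (m l) < f l x) ∧
        ∀ y, (∀ l, l ≠ k → f l (m l) < f l y) → f k y ≤ f k x := by
  obtain ⟨i, -, j, -, hij, hmij⟩ := Finset.exists_ne_map_eq_of_card_lt_of_maps_to
    (s := (Finset.univ : Finset I)) (t := τ) (f := m)
    (by rw [Finset.card_univ]; omega) (fun i _ => (hm i).1)
  refine ⟨i, j, hij, fun x => ⟨?_, ?_⟩⟩
  · rintro ⟨hx, hS⟩
    obtain ⟨m', hm'⟩ := exists_minimizers f (S := insert x τ) ⟨x, Finset.mem_insert_self _ _⟩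
    have himg := hS.image_eq hf hm'
    have hinj : Function.Injective m' := by
      have : (Finset.univ.image m').card = (Finset.univ : Finset I).card := by
        rw [himg, Finset.card_insert_of_notMem hx, hcard, Finset.card_univ]
      have := Finset.card_image_iff.1 this
      simpa using this
    obtain ⟨k, -, hk⟩ := Finset.mem_image.1 (himg ▸ Finset.mem_insert_self x τ)
    have hlt : ∀ l, l ≠ k → m' l = m l ∧ f l (m l) < f l x := by
      intro l hl
      have hne' : m' l ≠ x := fun h => hl (hinj (h.trans hk.symm))
      have hmem : m' l ∈ τ := (Finset.mem_insert.1 (hm' l).1).resolve_left hne'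
      have heq : m' l = m l := hf l (le_antisymm
        ((hm' l).2 _ (Finset.mem_insert_of_mem (hm l).1)) ((hm l).2 _ hmem))
      refine ⟨heq, lt_of_le_of_ne ?_ ?_⟩
      · rw [← heq]; exact (hm' l).2 x (Finset.mem_insert_self _ _)
      · intro h; exact hne' (heq.trans (hf l h))
    refine ⟨k, ?_, fun l hl => (hlt l hl).2, ?_⟩
    · by_contra hcon
      push Not at hcon
      apply hij
      apply hinj
      rw [(hlt i (Ne.symm hcon.1)).1, (hlt j (Ne.symm hcon.2)).1, hmij]
    · intro y hy
      obtain ⟨l, hl⟩ := hS y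
      by_cases hlk : l = k
      · subst hlk; exact hl x (Finset.mem_insert_self _ _)
      · exact absurd (hl _ (Finset.mem_insert_of_mem (hm l).1)) (not_le.2 (hy l hlk))
  · rintro ⟨k, hk, hlt, hmax⟩
    constructor
    · intro hx
      obtain ⟨l, -, rfl⟩ := Finset.mem_image.1 ((hτ.image_eq hf hm).symm ▸ hx)
      by_cases hlk : l = k
      · subst hlk
        rcases hk with rfl | rfl
        · have := hlt j hij.symm
          rw [hmij] at this; exact lt_irrefl _ this
        · have := hlt i hij
          rw [hmij] at this; exact lt_irrefl _ this
      · exact lt_irrefl _ (hlt l hlk)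
    · intro y
      by_cases hy : ∀ l, l ≠ k → f l (m l) < f l y
      · obtain ⟨l, hl⟩ := hτ y
        have hlk : l = k := by
          by_contra hlk
          exact absurd (hl _ (hm l).1) (not_le.2 (hy l hlk))
        subst hlk
        refine ⟨l, fun z hz => ?_⟩
        rcases Finset.mem_insert.1 hz with rfl | hz
        · exact hmax y hy
        · exact hl z hz
      · push Not at hy
        obtain ⟨l, hlk, hl⟩ := hy
        refine ⟨l, fun z hz => ?_⟩
        rcases Finset.mem_insert.1 hz with rfl | hz
        · exact hl.trans (hlt l hlk).le
        · exact hl.trans ((hm l).2 z hz)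

open Classical in
/-- The replacement property: if on each scale `k` some point lies above all minima of `τ` on the
other scales, then exactly two points complete `τ`. -/
theorem card_completions_eq_two [Fintype X] {f : I → X → α} (hf : ∀ i, Function.Injective (f i))
    {τ : Finset X} (hτ : IsDominated f τ)
    (hcard : τ.card + 1 = Fintype.card I) {m : I → X}
    (hm : ∀ i, m i ∈ τ ∧ ∀ x ∈ τ, f i (m i) ≤ f i x)
    (habove : ∀ k, ∃ y, ∀ l, l ≠ k → f l (m l) < f l y) :
    (Finset.univ.filter fun x => x ∉ τ ∧ IsDominated f (insert x τ)).card = 2 := by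
  obtain ⟨i, j, hij, hiff⟩ := exists_pair_of_isDominated hf hτ hcard hm
  have hmax : ∀ k, ∃ x, (∀ l, l ≠ k → f l (m l) < f l x) ∧
      ∀ y, (∀ l, l ≠ k → f l (m l) < f l y) → f k y ≤ f k x := by
    intro k
    obtain ⟨y, hy⟩ := habove k
    obtain ⟨x, hx, hx'⟩ := (Finset.univ.filter fun x => ∀ l, l ≠ k → f l (m l) < f l x).exists_max_image
      (f k) ⟨y, by simpa using hy⟩
    exact ⟨x, by simpa using hx, fun z hz => hx' z (by simpa using hz)⟩
  choose b hb hb' using hmax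
  rw [Finset.card_eq_two]
  refine ⟨b i, b j, ?_, ?_⟩
  · intro h
    obtain ⟨l, hl⟩ := hτ (b i)
    by_cases hli : l = i
    · have := hb j l (hli ▸ hij)
      rw [← h] at this
      exact absurd (hl _ (hm l).1) (not_le.2 this)
    · exact absurd (hl _ (hm l).1) (not_le.2 (hb i l hli))
  · ext x
    rw [Finset.mem_filter, Finset.mem_insert, Finset.mem_singleton]
    simp only [Finset.mem_univ, true_and]
    rw [hiff x]
    constructor
    · rintro ⟨k, hk, h1, h2⟩
      have : x = b k := hf k (le_antisymm (hb' k x h1) (h2 _ (hb k)))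
      rcases hk with rfl | rfl
      · exact Or.inl this
      · exact Or.inr this
    · rintro (rfl | rfl)
      · exact ⟨i, Or.inl rfl, hb i, hb' i⟩
      · exact ⟨j, Or.inr rfl, hb j, hb' j⟩

open Classical in
/-- A set of full size that is not fully coloured has either no or two points whose removal leaves
exactly the colours other than `i₀`. -/
theorem even_card_removable (c : X → I) (i₀ : I) {S : Finset X}
    (hcard : S.card = Fintype.card I) (hc : S.image c ≠ Finset.univ) :
    Even (S.filter fun x => (S.erase x).image c = Finset.univ.erase i₀).card := by
  rcases (S.filter fun x => (S.erase x).image c = Finset.univ.erase i₀).eq_empty_or_nonempty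
    with h0 | ⟨x, hx⟩
  · rw [h0]; simp
  obtain ⟨hxS, hx⟩ := Finset.mem_filter.1 hx
  have hinj : ∀ y ∈ S, (S.erase y).image c = Finset.univ.erase i₀ →
      Set.InjOn c (S.erase y : Finset X) := by
    intro y hy h
    apply Finset.card_image_iff.1
    rw [h, Finset.card_erase_of_mem (Finset.mem_univ _), Finset.card_erase_of_mem hy, hcard,
      Finset.card_univ]
  have hcx : c x ≠ i₀ := by
    intro h
    apply hc
    rw [← Finset.insert_erase hxS, Finset.image_insert, hx, h,
      Finset.insert_erase (Finset.mem_univ _)]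
  have : c x ∈ (S.erase x).image c := by
    rw [hx]; exact Finset.mem_erase.2 ⟨hcx, Finset.mem_univ _⟩
  obtain ⟨x', hx', hcx'⟩ := Finset.mem_image.1 this
  obtain ⟨hxx', hx'S⟩ := Finset.mem_erase.1 hx'
  have hswap : (S.erase x').image c = (S.erase x).image c := by
    have h1 : S.erase x' = insert x ((S.erase x).erase x') := by
      ext z
      simp only [Finset.mem_erase, Finset.mem_insert]
      by_cases hz : z = x
      · subst hz; simp [hxS, hxx'.symm]
      · simp [hz]
    have h2 : S.erase x = insert x' ((S.erase x).erase x') := (Finset.insert_erase hx').symm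
    rw [h1, Finset.image_insert]
    conv_rhs => rw [h2, Finset.image_insert, hcx']
  have : (S.filter fun x => (S.erase x).image c = Finset.univ.erase i₀) = {x, x'} := by
    ext y
    simp only [Finset.mem_filter, Finset.mem_insert, Finset.mem_singleton]
    constructor
    · rintro ⟨hy, hyc⟩
      by_contra hcon
      push Not at hcon
      exact hxx' (hinj y hy hyc (by simp [hx'S, hcon.2.symm]) (by simp [hxS, hcon.1.symm]) hcx')
    · rintro (rfl | rfl)
      · exact ⟨hxS, hx⟩
      · exact ⟨hx'S, hswap.trans hx⟩
  rw [this, Finset.card_pair hxx'.symm]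
  exact even_two

open Classical in
/-- The parity argument. The points `e i` are corners: `e i` is lowest on scale `i`, above all
other points on the remaining scales, and has colour `i`. Pairs of a dominated set of full size and
a point whose removal leaves all colours but `i₀` are counted twice: grouped by the smaller set
their number is odd, because the face of all corners but `e i₀` has a single completion; grouped
by the larger set it would be even without a fully coloured one. -/
theorem exists_dominated_rainbow [Fintype X] {f : I → X → α} (hf : ∀ i, Function.Injective (f i))
    (c : X → I) (e : I → X) (hce : ∀ i, c (e i) = i)
    (hlow : ∀ i x, x ∉ Set.range e → f i (e i) < f i x)
    (hlow' : ∀ i j, f i (e i) ≤ f i (e j))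
    (hhigh : ∀ i j x, j ≠ i → x ∉ Set.range e → f i x < f i (e j))
    (hX : ∃ x, x ∉ Set.range e) [Nonempty I] :
    ∃ S : Finset X, S.card = Fintype.card I ∧ S.image c = Finset.univ ∧ IsDominated f S := by
  by_contra hno
  push Not at hno
  obtain ⟨i₀⟩ := ‹Nonempty I›
  have heinj : Function.Injective e := fun i j h => by rw [← hce i, h, hce]
  let pairs : Finset (Finset X × X) := Finset.univ.filter fun q =>
    q.1.card + 1 = Fintype.card I ∧ q.1.image c = Finset.univ.erase i₀ ∧ q.2 ∉ q.1 ∧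
      IsDominated f (insert q.2 q.1)
  have heven : Even pairs.card := by
    rw [Finset.card_eq_sum_card_fiberwise (f := fun q : Finset X × X => insert q.2 q.1)
      (t := Finset.univ) (fun _ _ => Finset.mem_univ _)]
    refine Finset.even_sum _ fun S _ => ?_
    rcases (pairs.filter fun q => insert q.2 q.1 = S).eq_empty_or_nonempty with h0 | ⟨q, hq⟩
    · rw [h0]; simp
    obtain ⟨hq, hqS⟩ := Finset.mem_filter.1 hq
    obtain ⟨hq1, hq2, hq3, hq4⟩ := (Finset.mem_filter.1 hq).2
    rw [hqS] at hq4
    have hS : S.card = Fintype.card I := by rw [← hqS, Finset.card_insert_of_notMem hq3, hq1]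
    suffices h : (pairs.filter fun q => insert q.2 q.1 = S).card =
        (S.filter fun x => (S.erase x).image c = Finset.univ.erase i₀).card by
      rw [h]
      exact even_card_removable c i₀ hS fun h => hno S hS h hq4
    refine Finset.card_bij (fun q _ => q.2) ?_ ?_ ?_
    · rintro ⟨τ, x⟩ h
      obtain ⟨h, hS'⟩ := Finset.mem_filter.1 h
      obtain ⟨-, h1, h2, h3, h4⟩ := Finset.mem_filter.1 h
      simp only at h1 h2 h3 h4 hS'
      refine Finset.mem_filter.2 ⟨?_, ?_⟩
      · rw [← hS']; exact Finset.mem_insert_self _ _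
      · rw [← hS', Finset.erase_insert h3, h2]
    · rintro ⟨τ, x⟩ h ⟨τ', x'⟩ h' hxx
      obtain ⟨h, hS1⟩ := Finset.mem_filter.1 h
      obtain ⟨-, -, -, h3, -⟩ := Finset.mem_filter.1 h
      obtain ⟨h', hS2⟩ := Finset.mem_filter.1 h'
      obtain ⟨-, -, -, h3', -⟩ := Finset.mem_filter.1 h'
      simp only at h3 h3' hxx hS1 hS2
      subst hxx
      rw [← Finset.erase_insert h3, ← Finset.erase_insert h3', hS1, hS2]
    · intro x hx
      obtain ⟨hxS, hx⟩ := Finset.mem_filter.1 hx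
      refine ⟨(S.erase x, x), ?_, rfl⟩
      have hins := Finset.insert_erase hxS
      refine Finset.mem_filter.2 ⟨Finset.mem_filter.2 ⟨Finset.mem_univ _, ?_, hx, ?_, ?_⟩, hins⟩
      · rw [Finset.card_erase_add_one hxS, hS]
      · exact Finset.notMem_erase _ _
      · rw [hins]; exact hq4
  have hcompl : ∀ τ : Finset X, τ.card + 1 = Fintype.card I → τ.image c = Finset.univ.erase i₀ →
      (pairs.filter fun q => q.1 = τ).card =
        (Finset.univ.filter fun x => x ∉ τ ∧ IsDominated f (insert x τ)).card := by
    intro τ h1 h2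
    refine Finset.card_bij (fun q _ => q.2) ?_ ?_ ?_
    · rintro ⟨τ', x⟩ h
      obtain ⟨h, hτ⟩ := Finset.mem_filter.1 h
      obtain ⟨-, -, -, h3, h4⟩ := Finset.mem_filter.1 h
      simp only at hτ h3 h4
      subst hτ
      exact Finset.mem_filter.2 ⟨Finset.mem_univ _, h3, h4⟩
    · rintro ⟨τ', x⟩ h ⟨τ'', x'⟩ h' hxx
      have ha := (Finset.mem_filter.1 h).2
      have hb := (Finset.mem_filter.1 h').2
      simp only at ha hb hxx
      rw [ha, hb, hxx]
    · intro x hx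
      obtain ⟨-, h3, h4⟩ := Finset.mem_filter.1 hx
      exact ⟨(τ, x), Finset.mem_filter.2 ⟨Finset.mem_filter.2 ⟨Finset.mem_univ _, h1, h2, h3, h4⟩,
        rfl⟩, rfl⟩
  set τ₀ : Finset X := (Finset.univ.erase i₀).image e
  have hτ₀c : τ₀.image c = Finset.univ.erase i₀ := by
    rw [Finset.image_image]
    simp [Function.comp_def, hce]
  have hτ₀card : τ₀.card + 1 = Fintype.card I := by
    rw [Finset.card_image_of_injective _ heinj, Finset.card_erase_add_one (Finset.mem_univ _),
      Finset.card_univ]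
  have hτ₀mem : ∀ x, x ∈ τ₀ ↔ ∃ l, l ≠ i₀ ∧ e l = x := by
    intro x; simp [τ₀]
  have hone : (pairs.filter fun q => q.1 = τ₀).card = 1 := by
    rw [hcompl τ₀ hτ₀card hτ₀c, Finset.card_eq_one]
    obtain ⟨t, ht⟩ := hX
    obtain ⟨b, hb, hbmax⟩ := (Finset.univ.filter fun x => x ∉ Set.range e).exists_max_image
      (f i₀) ⟨t, by simpa using ht⟩
    replace hb : b ∉ Set.range e := (Finset.mem_filter.1 hb).2
    replace hbmax : ∀ y, y ∉ Set.range e → f i₀ y ≤ f i₀ b := fun y hy =>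
      hbmax y (Finset.mem_filter.2 ⟨Finset.mem_univ _, hy⟩)
    refine ⟨b, ?_⟩
    -- on the scales other than `i₀`, corners of the face keep every non-corner off the minimum
    have honly : ∀ x y i, y ∉ Set.range e → (∀ z ∈ insert x τ₀, f i y ≤ f i z) → i = i₀ := by
      intro x y i hy h
      by_contra hi
      exact absurd (h (e i) (Finset.mem_insert_of_mem ((hτ₀mem _).2 ⟨i, hi, rfl⟩)))
        (not_le.2 (hlow i y hy))
    ext x
    rw [Finset.mem_filter, Finset.mem_singleton]
    constructor
    · rintro ⟨-, hx, hdom⟩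
      have hxe : x ∉ Set.range e := by
        rintro ⟨i, rfl⟩
        have hi : i = i₀ := by
          by_contra hi
          exact hx ((hτ₀mem _).2 ⟨i, hi, rfl⟩)
        subst hi
        obtain ⟨k, hk⟩ := hdom b
        obtain rfl := honly _ b k hb hk
        exact absurd (hk _ (Finset.mem_insert_self _ _)) (not_le.2 (hlow k b hb))
      obtain ⟨k, hk⟩ := hdom b
      obtain rfl := honly _ b k hb hk
      exact hf k (le_antisymm (hbmax x hxe) (hk _ (Finset.mem_insert_self _ _)))
    · rintro rfl
      refine ⟨Finset.mem_univ _, fun h => ?_, fun y => ?_⟩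
      · obtain ⟨l, -, hl⟩ := (hτ₀mem _).1 h
        exact hb ⟨l, hl⟩
      · by_cases hy : y ∈ Set.range e
        · obtain ⟨k, rfl⟩ := hy
          refine ⟨k, fun z _ => ?_⟩
          by_cases hz : z ∈ Set.range e
          · obtain ⟨l, rfl⟩ := hz; exact hlow' k l
          · exact (hlow k z hz).le
        · refine ⟨i₀, fun z hz => ?_⟩
          rcases Finset.mem_insert.1 hz with rfl | hz
          · exact hbmax y hy
          · obtain ⟨l, hl, rfl⟩ := (hτ₀mem _).1 hz
            exact (hhigh i₀ l y hl hy).le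
  have hother : ∀ τ : Finset X, τ ≠ τ₀ → Even (pairs.filter fun q => q.1 = τ).card := by
    intro τ hτ
    rcases (pairs.filter fun q => q.1 = τ).eq_empty_or_nonempty with h0 | ⟨q, hq⟩
    · rw [h0]; simp
    obtain ⟨hq, hqτ⟩ := Finset.mem_filter.1 hq
    obtain ⟨h1, h2, h3, h4⟩ := (Finset.mem_filter.1 hq).2
    subst hqτ
    rw [hcompl q.1 h1 h2]
    have hdom : IsDominated f q.1 := h4.mono (Finset.subset_insert _ _)
    have ht : ∃ t ∈ q.1, t ∉ Set.range e := by
      by_contra hcon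
      push Not at hcon
      apply hτ
      apply Finset.eq_of_subset_of_card_le
      · intro x hx
        obtain ⟨l, rfl⟩ := hcon x hx
        have : c (e l) ∈ q.1.image c := Finset.mem_image_of_mem _ hx
        rw [h2, hce] at this
        exact (hτ₀mem _).2 ⟨l, Finset.ne_of_mem_erase this, rfl⟩
      · omega
    obtain ⟨t, htq, ht⟩ := ht
    obtain ⟨m, hm⟩ := exists_minimizers f ⟨t, htq⟩
    rw [card_completions_eq_two hf hdom h1 hm fun k =>
      ⟨e k, fun l hl => ((hm l).2 t htq).trans_lt (hhigh l k t hl.symm ht)⟩]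
    exact even_two
  have hodd : ¬ Even pairs.card := by
    rw [Finset.card_eq_sum_card_fiberwise (f := Prod.fst)
      (t := (Finset.univ : Finset (Finset X))) (fun _ _ => Finset.mem_univ _),
      ← Finset.add_sum_erase _ _ (Finset.mem_univ τ₀), hone, Nat.even_add]
    have := Finset.even_sum (s := Finset.univ.erase τ₀)
      (f := fun τ => (pairs.filter fun q => q.1 = τ).card)
      (fun τ h => hother τ (Finset.ne_of_mem_erase h))
    simp [this]
  exact hodd heven

end Parity

/-- Scarf's lemma: for any scales `g i` and any colouring of a finite set by the scales, some
nonempty set `σ` is dominated already on the scales that occur as colours in `σ`. -/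
theorem exists_dominated_by_colours {T I : Type*} [Fintype T] [Nonempty T] [Fintype I]
    [DecidableEq I] (g : I → T → ℕ) (c : T → I) :
    ∃ σ : Finset T, σ.Nonempty ∧ ∀ y, ∃ i ∈ σ.image c, ∀ x ∈ σ, g i y ≤ g i x := by
  classical
  -- add a corner for each scale and break ties lexicographically
  let B : ℕ := ∑ i, ∑ t, g i t
  have hB : ∀ i t, g i t ≤ B := fun i t =>
    (Finset.single_le_sum (f := fun t => g i t) (fun _ _ => Nat.zero_le _)
      (Finset.mem_univ t)).trans
    (Finset.single_le_sum (f := fun i => ∑ t, g i t) (fun _ _ => Nat.zero_le _)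
      (Finset.mem_univ i))
  let key : I → T ⊕ I → ℕ := fun i => Sum.elim (fun t => g i t + 1)
    (fun j => if j = i then 0 else B + 2)
  let f : I → T ⊕ I → ℕ ×ₗ Fin (Fintype.card (T ⊕ I)) := fun i x =>
    toLex (key i x, Fintype.equivFin (T ⊕ I) x)
  have hlt : ∀ i x y, key i x < key i y → f i x < f i y := fun i x y h =>
    Prod.Lex.toLex_lt_toLex.2 (Or.inl h)
  have hle : ∀ i x y, f i x ≤ f i y → key i x ≤ key i y := fun i x y h => by
    by_contra hc
    exact absurd h (not_le.2 (hlt i y x (not_le.1 hc)))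
  have hf : ∀ i, Function.Injective (f i) := by
    intro i x y h
    have := congrArg (fun z => (ofLex z).2) h
    simpa [f] using this
  have : Nonempty I := ⟨c (Classical.arbitrary T)⟩
  have hinl : ∀ x : T ⊕ I, x ∉ Set.range (Sum.inr : I → T ⊕ I) → ∃ t, x = Sum.inl t := by
    rintro (t | i) h
    · exact ⟨t, rfl⟩
    · exact absurd ⟨i, rfl⟩ h
  obtain ⟨S, -, hSc, hS⟩ := exists_dominated_rainbow hf (Sum.elim c id) Sum.inr (fun i => rfl)
    (by
      intro i x hx
      obtain ⟨t, rfl⟩ := hinl x hx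
      exact hlt _ _ _ (by simp [key]))
    (by
      intro i j
      by_cases h : j = i
      · rw [h]
      · exact (hlt _ _ _ (by simp [key, h])).le)
    (by
      intro i j x hj hx
      obtain ⟨t, rfl⟩ := hinl x hx
      exact hlt _ _ _ (by have := hB i t; simp [key, hj]; omega))
    ⟨Sum.inl (Classical.arbitrary T), by simp⟩
  let σ : Finset T := Finset.univ.filter fun t => Sum.inl t ∈ S
  have hmem : ∀ t, t ∈ σ ↔ Sum.inl t ∈ S := fun t => by simp [σ]
  have hdom : ∀ y, ∃ i ∈ σ.image c, ∀ x ∈ σ, g i y ≤ g i x := by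
    intro y
    obtain ⟨i, hi⟩ := hS (Sum.inl y)
    refine ⟨i, ?_, fun x hx => ?_⟩
    · obtain ⟨x, hx, hxi⟩ := Finset.mem_image.1 (hSc.symm ▸ Finset.mem_univ i)
      rcases x with t | j
      · exact Finset.mem_image.2 ⟨t, (hmem t).2 hx, hxi⟩
      · have : j = i := hxi
        subst this
        have := hle _ _ _ (hi _ hx)
        simp [key] at this
    · have := hle _ _ _ (hi _ ((hmem x).1 hx))
      simpa [key] using this
  refine ⟨σ, ?_, hdom⟩
  obtain ⟨i, hi, -⟩ := hdom (Classical.arbitrary T)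
  obtain ⟨t, ht, -⟩ := Finset.mem_image.1 hi
  exact ⟨t, ht⟩

end Scarf

/-! ### Equilibria of bimatrix games -/

/-- Grid points approximating an equilibrium: for a colouring `c` of the points of the simplex by
coordinates there are, at every mesh `n / k`, a point `x` of the simplex and a set of colours such
that `x` is nearly zero off these colours and each of them occurs near `x`. -/
theorem exists_near_colours {I : Type*} [Fintype I] [Nonempty I] (c : (I → ℝ) → I)
    {k : ℕ} (hk : 0 < k) :
    ∃ x ∈ stdSimplex ℝ I, ∀ i, Fintype.card I / (k : ℝ) < x i →
      ∃ y ∈ stdSimplex ℝ I, c y = i ∧ ∀ j, |y j - x j| ≤ Fintype.card I / (k : ℝ) := by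
  classical
  have hk' : (0 : ℝ) < k := by exact_mod_cast hk
  let T := {v : I → Fin (k + 1) // ∑ i, (v i : ℕ) = k}
  let pt : T → I → ℝ := fun v i => ((v.1 i : ℕ) : ℝ) / k
  have hpt : ∀ v, pt v ∈ stdSimplex ℝ I := by
    intro v
    refine ⟨fun i => by positivity, ?_⟩
    have : (∑ i, ((v.1 i : ℕ) : ℝ)) = k := by exact_mod_cast v.2
    simp only [pt]
    rw [← Finset.sum_div, this, div_self hk'.ne']
  have hmk : ∀ v : I → ℕ, ∑ i, v i = k → ∃ t : T, ∀ i, (t.1 i : ℕ) = v i := by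
    intro v hv
    have hle : ∀ i, v i < k + 1 := fun i => by
      have := Finset.single_le_sum (f := v) (fun _ _ => Nat.zero_le _) (Finset.mem_univ i)
      omega
    exact ⟨⟨fun i => ⟨v i, hle i⟩, hv⟩, fun i => rfl⟩
  -- raising any tuple of total at most `k` in one coordinate gives a grid point above it
  have habove : ∀ v : I → ℕ, ∑ i, v i ≤ k → ∃ t : T, ∀ i, v i ≤ t.1 i := by
    intro v hv
    obtain ⟨i₀⟩ := ‹Nonempty I›
    obtain ⟨t, ht⟩ := hmk (fun i => v i + if i = i₀ then k - ∑ i, v i else 0) (by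
      rw [Finset.sum_add_distrib, Finset.sum_ite_eq' Finset.univ i₀, if_pos (Finset.mem_univ _)]
      omega)
    exact ⟨t, fun i => by rw [ht]; omega⟩
  have : Nonempty T := let ⟨t, _⟩ := habove (fun _ => 0) (by simp); ⟨t⟩
  obtain ⟨σ, ⟨x, hx⟩, hσ⟩ := Scarf.exists_dominated_by_colours
    (fun (i : I) (t : T) => (t.1 i : ℕ)) (fun t => c (pt t))
  obtain ⟨m, hm⟩ := Scarf.exists_minimizers (fun (i : I) (t : T) => (t.1 i : ℕ)) ⟨x, hx⟩
  let C := σ.image fun t => c (pt t)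
  let lo : I → ℕ := fun i => if i ∈ C then (m i).1 i else 0
  have hlo : ∀ t ∈ σ, ∀ i, lo i ≤ t.1 i := by
    intro t ht i
    simp only [lo]
    split_ifs
    · exact (hm i).2 t ht
    · exact Nat.zero_le _
  -- otherwise a grid point would exceed the minima of `σ` on all colours of `σ`
  have hsum : k < ∑ i, (lo i + 1) := by
    by_contra hcon
    obtain ⟨t, ht⟩ := habove _ (not_lt.1 hcon)
    obtain ⟨i, hi, hle⟩ := hσ t
    have h1 := hle _ (hm i).1
    have h2 := ht i
    simp only [lo, if_pos (show i ∈ C from hi)] at h2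
    omega
  rw [Finset.sum_add_distrib, Finset.sum_const, smul_eq_mul, mul_one, Finset.card_univ] at hsum
  have hclose : ∀ t ∈ σ, ∀ i, (t.1 i : ℕ) ≤ lo i + Fintype.card I := by
    intro t ht i
    have h1 : ∑ j, ((t.1 j : ℕ) - lo j) + ∑ j, lo j = k := by
      rw [← Finset.sum_add_distrib]
      exact (Finset.sum_congr rfl fun j _ => Nat.sub_add_cancel (hlo t ht j)).trans t.2
    have h2 := Finset.single_le_sum (f := fun j => (t.1 j : ℕ) - lo j)
      (fun _ _ => Nat.zero_le _) (Finset.mem_univ i)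
    have h3 := hlo t ht i
    omega
  refine ⟨pt x, hpt x, fun i hi => ?_⟩
  have hiC : i ∈ C := by
    by_contra hiC
    have := hclose x hx i
    simp only [lo, if_neg hiC, zero_add] at this
    exact absurd hi (not_lt.2 (div_le_div_of_nonneg_right (by exact_mod_cast this) hk'.le))
  obtain ⟨y, hy, hyi⟩ := Finset.mem_image.1 hiC
  refine ⟨pt y, hpt y, hyi, fun j => ?_⟩
  simp only [pt]
  rw [← sub_div, abs_div, abs_of_pos hk']
  refine div_le_div_of_nonneg_right ?_ hk'.le
  have h1 : ((y.1 j : ℕ) : ℝ) ≤ lo j + Fintype.card I := by exact_mod_cast hclose y hy j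
  have h2 : ((x.1 j : ℕ) : ℝ) ≤ lo j + Fintype.card I := by exact_mod_cast hclose x hx j
  have h3 : ((lo j : ℕ) : ℝ) ≤ (y.1 j : ℕ) := by exact_mod_cast hlo y hy j
  have h4 : ((lo j : ℕ) : ℝ) ≤ (x.1 j : ℕ) := by exact_mod_cast hlo x hx j
  rw [abs_le]
  constructor <;> linarith

/-- Equilibria of population games: for a continuous payoff field `F` on the simplex some point has
only best responses in its support. -/
theorem exists_support_subset_argmax {I : Type*} [Fintype I] [Nonempty I]
    (F : (I → ℝ) → I → ℝ) (hF : Continuous F) :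
    ∃ x ∈ stdSimplex ℝ I, ∀ i, 0 < x i → ∀ j, F x j ≤ F x i := by
  classical
  have hbest : ∀ x : I → ℝ, ∃ i, ∀ j, F x j ≤ F x i := fun x => Finite.exists_max (F x)
  choose c hc using hbest
  choose x hx hxy using fun k : ℕ => exists_near_colours c (Nat.succ_pos k)
  obtain ⟨z, hz, φ, hφ, hlim⟩ := (isCompact_stdSimplex ℝ I).tendsto_subseq hx
  refine ⟨z, hz, fun i hi j => ?_⟩
  have hmesh : Filter.Tendsto (fun k : ℕ => (Fintype.card I : ℝ) / ((φ k).succ : ℕ))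
      Filter.atTop (nhds 0) := by
    have h1 := (tendsto_const_div_atTop_nhds_zero_nat (Fintype.card I : ℝ)).comp
      (Filter.tendsto_add_atTop_nat 1)
    exact h1.comp hφ.tendsto_atTop
  have hi' : ∀ᶠ k in Filter.atTop, (Fintype.card I : ℝ) / ((φ k).succ : ℕ) < x (φ k) i :=
    hmesh.eventually_lt ((continuous_apply i).tendsto z |>.comp hlim) hi
  have hy : ∀ k, ∃ y : I → ℝ,
      (Fintype.card I : ℝ) / ((φ k).succ : ℕ) < x (φ k) i → c y = i ∧
        ∀ j, |y j - x (φ k) j| ≤ Fintype.card I / ((φ k).succ : ℕ) := by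
    intro k
    by_cases h : (Fintype.card I : ℝ) / ((φ k).succ : ℕ) < x (φ k) i
    · obtain ⟨y, -, h1, h2⟩ := hxy (φ k) i h
      exact ⟨y, fun _ => ⟨h1, h2⟩⟩
    · exact ⟨0, fun h' => absurd h' h⟩
  choose y hy using hy
  have hylim : Filter.Tendsto y Filter.atTop (nhds z) := by
    rw [tendsto_pi_nhds]
    intro l
    have h1 : Filter.Tendsto (fun k => y k l - x (φ k) l) Filter.atTop (nhds 0) :=
      squeeze_zero_norm' (hi'.mono fun k hk => (hy k hk).2 l) hmesh
    have h2 : Filter.Tendsto (fun k => x (φ k) l) Filter.atTop (nhds (z l)) :=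
      ((continuous_apply l).tendsto z).comp hlim
    simpa using h1.add h2
  have hFl : ∀ l, Filter.Tendsto (fun k => F (y k) l) Filter.atTop (nhds (F z l)) := fun l =>
    (((continuous_apply l).comp hF).tendsto z).comp hylim
  refine le_of_tendsto_of_tendsto (hFl j) (hFl i) (hi'.mono fun k hk => ?_)
  have := hc (y k) j
  rwa [(hy k hk).1] at this

theorem div_sum_mem_stdSimplex {R : Type*} [Fintype R] {u : R → ℝ} (hu : ∀ r, 0 ≤ u r)
    (hpos : 0 < ∑ r, u r) : (fun r => u r / ∑ r, u r) ∈ stdSimplex ℝ R :=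
  ⟨fun r => div_nonneg (hu r) hpos.le, by rw [← Finset.sum_div, div_self hpos.ne']⟩

theorem sum_div_sum_mul_le_of_shift {R : Type*} [Fintype R] {u E E' : R → ℝ} {K : ℝ}
    (hpos : 0 < ∑ r, u r) (h : ∑ r, u r * (E r + K) ≤ ∑ r, u r * (E' r + K)) :
    ∑ r, u r / (∑ r, u r) * E r ≤ ∑ r, u r / (∑ r, u r) * E' r := by
  simp only [mul_add, Finset.sum_add_distrib, add_le_add_iff_right] at h
  simp only [div_mul_eq_mul_div, ← Finset.sum_div]
  exact div_le_div_of_nonneg_right h hpos.le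

/-- Nash's theorem for two players: a bimatrix game has mixed strategies all of whose pure
strategies in the support are best responses. -/
theorem exists_bimatrix_equilibrium {P Q : Type*} [Fintype P] [Fintype Q] [Nonempty P] [Nonempty Q]
    (A : P → Q → ℝ) (B : Q → P → ℝ) :
    ∃ x ∈ stdSimplex ℝ P, ∃ y ∈ stdSimplex ℝ Q,
      (∀ p, 0 < x p → ∀ p', ∑ q, y q * A p' q ≤ ∑ q, y q * A p q) ∧
      (∀ q, 0 < y q → ∀ q', ∑ p, x p * B q' p ≤ ∑ p, x p * B q p) := by
  classical
  -- shift all payoffs to be positive and let one population play both roles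
  obtain ⟨K, hKA, hKB⟩ : ∃ K, (∀ p q, 0 < A p q + K) ∧ (∀ q p, 0 < B q p + K) := by
    obtain ⟨a, ha⟩ := (Set.finite_range fun z : P × Q => -A z.1 z.2).bddAbove
    obtain ⟨b, hb⟩ := (Set.finite_range fun z : Q × P => -B z.1 z.2).bddAbove
    refine ⟨max a b + 1, fun p q => ?_, fun q p => ?_⟩
    · have : -A p q ≤ a := ha ⟨(p, q), rfl⟩
      linarith [le_max_left a b]
    · have : -B q p ≤ b := hb ⟨(q, p), rfl⟩
      linarith [le_max_right a b]
  let F : (P ⊕ Q → ℝ) → P ⊕ Q → ℝ := fun z => Sum.elim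
    (fun p => ∑ q, z (Sum.inr q) * (A p q + K)) (fun q => ∑ p, z (Sum.inl p) * (B q p + K))
  have hF : Continuous F := by
    refine continuous_pi fun i => ?_
    rcases i with p | q
    · change Continuous fun z : P ⊕ Q → ℝ => ∑ q, z (Sum.inr q) * (A p q + K)
      fun_prop
    · change Continuous fun z : P ⊕ Q → ℝ => ∑ p, z (Sum.inl p) * (B q p + K)
      fun_prop
  obtain ⟨z, ⟨hz0, hz1⟩, hz⟩ := exists_support_subset_argmax F hF
  rw [Fintype.sum_sum_type] at hz1
  have hP : ∃ p, 0 < z (Sum.inl p) := by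
    by_contra hcon
    push Not at hcon
    have h0 : ∀ p, z (Sum.inl p) = 0 := fun p => le_antisymm (hcon p) (hz0 _)
    obtain ⟨q, hq⟩ : ∃ q, 0 < z (Sum.inr q) := by
      by_contra hcon'
      push Not at hcon'
      have h1 := Finset.sum_nonpos fun p (_ : p ∈ Finset.univ) => hcon p
      have h2 := Finset.sum_nonpos fun q (_ : q ∈ Finset.univ) => hcon' q
      linarith
    obtain ⟨p⟩ := ‹Nonempty P›
    have h1 : ∑ q, z (Sum.inr q) * (A p q + K) ≤ ∑ p, z (Sum.inl p) * (B q p + K) :=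
      hz _ hq (Sum.inl p)
    have h2 : 0 < ∑ q, z (Sum.inr q) * (A p q + K) :=
      Finset.sum_pos' (fun q _ => mul_nonneg (hz0 _) (hKA p q).le)
        ⟨q, Finset.mem_univ _, mul_pos hq (hKA p q)⟩
    simp only [h0, zero_mul, Finset.sum_const_zero] at h1
    linarith
  have hQ : ∃ q, 0 < z (Sum.inr q) := by
    by_contra hcon
    push Not at hcon
    have h0 : ∀ q, z (Sum.inr q) = 0 := fun q => le_antisymm (hcon q) (hz0 _)
    obtain ⟨p, hp⟩ := hP
    obtain ⟨q⟩ := ‹Nonempty Q›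
    have h1 : ∑ p, z (Sum.inl p) * (B q p + K) ≤ ∑ q, z (Sum.inr q) * (A p q + K) :=
      hz _ hp (Sum.inr q)
    have h2 : 0 < ∑ p, z (Sum.inl p) * (B q p + K) :=
      Finset.sum_pos' (fun p _ => mul_nonneg (hz0 _) (hKB q p).le)
        ⟨p, Finset.mem_univ _, mul_pos hp (hKB q p)⟩
    simp only [h0, zero_mul, Finset.sum_const_zero] at h1
    linarith
  have hX : 0 < ∑ p, z (Sum.inl p) :=
    let ⟨p, hp⟩ := hP
    Finset.sum_pos' (fun p _ => hz0 _) ⟨p, Finset.mem_univ _, hp⟩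
  have hY : 0 < ∑ q, z (Sum.inr q) :=
    let ⟨q, hq⟩ := hQ
    Finset.sum_pos' (fun q _ => hz0 _) ⟨q, Finset.mem_univ _, hq⟩
  exact ⟨_, div_sum_mem_stdSimplex (fun p => hz0 (Sum.inl p)) hX,
    _, div_sum_mem_stdSimplex (fun q => hz0 (Sum.inr q)) hY,
    fun p hp p' => sum_div_sum_mul_le_of_shift hY
      (hz _ ((div_pos_iff_of_pos_right hX).1 hp) (Sum.inl p')),
    fun q hq q' => sum_div_sum_mul_le_of_shift hX
      (hz _ ((div_pos_iff_of_pos_right hY).1 hq) (Sum.inr q'))⟩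

/-! ### Sampling from a finite distribution -/

/-- The exponential moment of a centred variable with values in `[-a, a]`. -/
theorem sum_mul_exp_le_of_centred {P : Type*} [Fintype P] {w Y : P → ℝ} {a : ℝ} (ha : 0 < a)
    (hw : ∀ p, 0 ≤ w p) (hw1 : ∑ p, w p = 1) (hY : ∀ p, |Y p| ≤ a) (hmean : ∑ p, w p * Y p = 0)
    (l : ℝ) : ∑ p, w p * Real.exp (l * Y p) ≤ Real.exp (l ^ 2 * a ^ 2 / 2) := by
  have hchord : ∀ p, Real.exp (l * Y p) ≤ Real.cosh (l * a) + Y p / a * Real.sinh (l * a) := by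
    intro p
    obtain ⟨h1, h2⟩ := abs_le.1 (hY p)
    have h := convexOn_exp.2 (Set.mem_univ (l * a)) (Set.mem_univ (-(l * a)))
      (show 0 ≤ (a + Y p) / (2 * a) by apply div_nonneg <;> linarith)
      (show 0 ≤ (a - Y p) / (2 * a) by apply div_nonneg <;> linarith)
      (by field_simp; ring)
    simp only [smul_eq_mul] at h
    rw [show (a + Y p) / (2 * a) * (l * a) + (a - Y p) / (2 * a) * (-(l * a)) = l * Y p by
      field_simp; ring] at h
    refine h.trans_eq ?_
    rw [Real.cosh_eq, Real.sinh_eq]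
    field_simp
    ring
  calc ∑ p, w p * Real.exp (l * Y p)
      ≤ ∑ p, w p * (Real.cosh (l * a) + Y p / a * Real.sinh (l * a)) :=
        Finset.sum_le_sum fun p _ => mul_le_mul_of_nonneg_left (hchord p) (hw p)
    _ = (∑ p, w p) * Real.cosh (l * a) + (∑ p, w p * Y p) * (Real.sinh (l * a) / a) := by
        rw [Finset.sum_mul, Finset.sum_mul, ← Finset.sum_add_distrib]
        exact Finset.sum_congr rfl fun p _ => by ring
    _ = Real.cosh (l * a) := by rw [hw1, hmean]; ring
    _ ≤ Real.exp ((l * a) ^ 2 / 2) := Real.cosh_le_exp_half_sq _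
    _ = _ := by rw [mul_pow]

/-- A nonnegative weighted average bounds some value taken with positive weight. -/
theorem exists_pos_weight_le {P : Type*} [Fintype P] {w f : P → ℝ} {b : ℝ}
    (hw : ∀ p, 0 ≤ w p) (hw1 : ∑ p, w p = 1) (h : ∑ p, w p * f p ≤ b) :
    ∃ p, 0 < w p ∧ f p ≤ b := by
  by_contra hcon
  push Not at hcon
  obtain ⟨p, -, hp⟩ : ∃ p ∈ Finset.univ, 0 < w p := by
    by_contra hc
    push Not at hc
    have := Finset.sum_nonpos hc
    linarith
  have : ∑ p, w p * b < ∑ p, w p * f p := by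
    refine Finset.sum_lt_sum (fun p _ => ?_) ⟨p, Finset.mem_univ _, ?_⟩
    · rcases (hw p).eq_or_lt with h0 | h0
      · rw [← h0]; simp
      · exact mul_le_mul_of_nonneg_left (hcon p h0).le h0.le
    · exact mul_lt_mul_of_pos_left (hcon p hp) hp
  rw [← Finset.sum_mul, hw1, one_mul] at this
  linarith

/-- Conditional expectations: sample points can be chosen one after the other so that the sum of
products of `k` factors stays below its expectation bound. -/
theorem exists_sample_prod_le {P J : Type*} [Fintype P] [Fintype J] {w : P → ℝ}
    (hw : ∀ p, 0 ≤ w p) (hw1 : ∑ p, w p = 1) (E : J → P → ℝ) (hE : ∀ s p, 0 ≤ E s p) (b : ℝ)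
    (hb : ∀ s, ∑ p, w p * E s p ≤ b) (k : ℕ) :
    ∃ q : Fin k → P, (∀ j, 0 < w (q j)) ∧ ∑ s, ∏ j, E s (q j) ≤ Fintype.card J * b ^ k := by
  rcases isEmpty_or_nonempty J with hJ | hJ
  · obtain ⟨p, hp, -⟩ := exists_pos_weight_le (f := fun _ => 0) (b := 0) hw hw1 (by simp)
    exact ⟨fun _ => p, fun _ => hp, by simp⟩
  have hb0 : 0 ≤ b := by
    obtain ⟨s⟩ := hJ
    exact (Finset.sum_nonneg fun p _ => mul_nonneg (hw p) (hE s p)).trans (hb s)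
  induction k with
  | zero => exact ⟨Fin.elim0, fun j => j.elim0, by simp⟩
  | succ k ih =>
    obtain ⟨q, hq, hle⟩ := ih
    obtain ⟨p, hp, hpb⟩ := exists_pos_weight_le (w := w)
      (f := fun p => ∑ s, E s p * ∏ j, E s (q j)) (b := Fintype.card J * b ^ (k + 1)) hw hw1 (by
        calc ∑ p, w p * ∑ s, E s p * ∏ j, E s (q j)
            = ∑ s, (∑ p, w p * E s p) * ∏ j, E s (q j) := by
              simp only [Finset.mul_sum, Finset.sum_mul, mul_assoc]
              exact Finset.sum_comm
          _ ≤ ∑ s, b * ∏ j, E s (q j) := Finset.sum_le_sum fun s _ =>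
              mul_le_mul_of_nonneg_right (hb s) (Finset.prod_nonneg fun j _ => hE s _)
          _ = b * ∑ s, ∏ j, E s (q j) := by rw [Finset.mul_sum]
          _ ≤ b * (Fintype.card J * b ^ k) := mul_le_mul_of_nonneg_left hle hb0
          _ = _ := by ring)
    refine ⟨Fin.cons p q, fun j => ?_, ?_⟩
    · refine Fin.cases ?_ (fun j => ?_) j
      · exact hp
      · exact hq j
    · simpa only [Fin.prod_univ_succ, Fin.cons_zero, Fin.cons_succ] using hpb

/-- Sampling: if `k` is at least `2 a² log (2 |J|) / δ²`, some `k` points of the support of `w` have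
averages within `δ` of the `w`-averages for all of the `|J|` functions `g s` at once, when no
function deviates from its `w`-average by more than `a`. -/
theorem exists_sample_abs_sub_le {P J : Type*} [Fintype P] [Fintype J] {w : P → ℝ}
    (hw : ∀ p, 0 ≤ w p) (hw1 : ∑ p, w p = 1) (g : J → P → ℝ) {a δ : ℝ} (ha : 0 < a) (hδ : 0 < δ)
    (hg : ∀ s p, |g s p - ∑ p', w p' * g s p'| ≤ a) {k : ℕ} (hk : 0 < k)
    (hk' : 2 * a ^ 2 * Real.log (2 * Fintype.card J) ≤ k * δ ^ 2) :
    ∃ q : Fin k → P, (∀ j, 0 < w (q j)) ∧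
      ∀ s, |(∑ j, g s (q j)) / k - ∑ p, w p * g s p| ≤ δ := by
  set μ : J → ℝ := fun s => ∑ p, w p * g s p with hμ
  -- the optimal exponent in the Chernoff bound; the signs `ε` give both tails
  set l := δ / a ^ 2 with hl
  have hlpos : 0 < l := by positivity
  have hkpos : (0 : ℝ) < k := by exact_mod_cast hk
  let ε : Bool → ℝ := fun c => if c then 1 else -1
  have hε : ∀ c, |ε c| = 1 := by rintro (_ | _) <;> simp [ε]
  obtain ⟨q, hq, hle⟩ := exists_sample_prod_le (J := J × Bool) hw hw1
    (fun s p => Real.exp (l * (ε s.2 * (g s.1 p - μ s.1)))) (fun _ _ => (Real.exp_pos _).le)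
    (Real.exp (l ^ 2 * a ^ 2 / 2)) (fun s => sum_mul_exp_le_of_centred ha hw hw1
      (fun p => by rw [abs_mul, hε, one_mul]; exact hg s.1 p)
      (by
        have : ∀ p, w p * (ε s.2 * (g s.1 p - μ s.1)) =
            ε s.2 * (w p * g s.1 p) - ε s.2 * μ s.1 * w p := fun p => by ring
        simp only [this, Finset.sum_sub_distrib, ← Finset.mul_sum, hw1, mul_one]
        exact sub_self _) l) k
  refine ⟨q, hq, fun s => ?_⟩
  have hcard : (0 : ℝ) < Fintype.card J := by
    exact_mod_cast Fintype.card_pos_iff.2 ⟨s⟩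
  have hone : ∀ c, ε c * (∑ j, g s (q j) - k * μ s) ≤ k * δ := by
    intro c
    have h1 := (Finset.single_le_sum (f := fun s : J × Bool =>
      ∏ j, Real.exp (l * (ε s.2 * (g s.1 (q j) - μ s.1))))
      (fun _ _ => Finset.prod_nonneg fun _ _ => (Real.exp_pos _).le)
      (Finset.mem_univ (s, c))).trans hle
    simp only [← Real.exp_sum, ← Finset.mul_sum, Finset.sum_sub_distrib, Finset.sum_const,
      Finset.card_univ, Fintype.card_fin, nsmul_eq_mul, Fintype.card_prod, Fintype.card_bool,
      ← Real.exp_nat_mul] at h1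
    push_cast at h1
    have h2 := Real.log_le_log (Real.exp_pos _) h1
    rw [Real.log_exp, Real.log_mul (by positivity) (Real.exp_pos _).ne', Real.log_exp] at h2
    rw [mul_comm (Fintype.card J : ℝ) 2] at h2
    have h3 : Real.log (2 * Fintype.card J) ≤ k * δ ^ 2 / (2 * a ^ 2) := by
      rw [le_div_iff₀ (by positivity)]; linarith
    have h4 : l * (ε c * (∑ j, g s (q j) - k * μ s)) ≤ l * (k * δ) := by
      refine h2.trans ((add_le_add_left h3 _).trans_eq ?_)
      rw [hl, div_pow, div_mul_eq_mul_div, div_mul_eq_mul_div]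
      have := ha.ne'
      field_simp
      ring
    exact le_of_mul_le_mul_left h4 hlpos
  have h1 := hone true
  have h2 := hone false
  simp only [ε, if_true, Bool.false_eq_true, if_false] at h1 h2
  rw [show (∑ j, g s (q j)) / k - μ s = (∑ j, g s (q j) - k * μ s) / k by
      rw [sub_div, mul_div_cancel_left₀ _ hkpos.ne'], abs_div,
    abs_of_pos hkpos, div_le_iff₀ hkpos, abs_le]
  constructor <;> linarith

/-! ### Strategies and reach probabilities in extensive-form games -/

namespace ExtensiveGame

variable {ι Act Info : Type*} {G : ExtensiveGame ι Act Info} {i : ι}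

theorem mem_actions {h : List Act} {a : Act} : a ∈ G.actions h ↔ a :: h ∈ G.nodes :=
  mem_childActions

theorem isDecision_iff_turn {h : List Act} {a : Act} (hah : a :: h ∈ G.nodes) :
    G.IsDecision i h ↔ G.turn h = some i :=
  ⟨fun hh => hh.2.2, fun ht => ⟨G.parent_mem a h hah, ⟨a, mem_actions.2 hah⟩, ht⟩⟩

theorem sequence_cons_of_isDecision {h : List Act} (hh : G.IsDecision i h) (a : Act) :
    G.sequence i (a :: h) = (G.info h, a) :: G.sequence i h := by
  simp [sequence, hh.2.2]

theorem sequence_cons_of_not_isDecision {h : List Act} {a : Act} (hah : a :: h ∈ G.nodes)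
    (hh : ¬ G.IsDecision i h) : G.sequence i (a :: h) = G.sequence i h := by
  rw [isDecision_iff_turn hah] at hh
  simp [sequence, hh]

theorem BehaviorStrategy.reach_cons_of_isDecision (s : G.BehaviorStrategy i) {h : List Act}
    (hh : G.IsDecision i h) (a : Act) :
    s.reach (a :: h) = s.reach h * s.prob (G.infoAt h hh) a := by
  rw [reach, dif_pos hh]

theorem BehaviorStrategy.reach_cons_of_not_isDecision (s : G.BehaviorStrategy i) {h : List Act}
    (hh : ¬ G.IsDecision i h) (a : Act) : s.reach (a :: h) = s.reach h := by
  rw [reach, dif_neg hh, mul_one]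

instance : Finite (G.InfoSet i) := by
  have : Finite {h // G.IsDecision i h} :=
    (G.nodes.finite_toSet.subset fun _ hh => hh.1 : {h | G.IsDecision i h}.Finite)
  refine Finite.of_surjective (fun h : {h // G.IsDecision i h} => G.infoAt h.1 h.2) ?_
  rintro ⟨_, h, hh, rfl⟩
  exact ⟨⟨h, hh⟩, rfl⟩

noncomputable instance : Fintype (G.InfoSet i) := Fintype.ofFinite _

/-- The actions available at an information set. -/
noncomputable def infoActions (I : G.InfoSet i) : Finset Act :=
  G.actions I.2.choose

theorem infoActions_infoAt {h : List Act} (hh : G.IsDecision i h) :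
    infoActions (G.infoAt h hh) = G.actions h := by
  have h' := (G.infoAt h hh).2.choose_spec
  exact G.info_actions i _ h h'.1.1 hh.1 h'.1.2.1 hh.2.1 h'.1.2.2 hh.2.2 h'.2

theorem exists_infoAt_eq (I : G.InfoSet i) : ∃ h, ∃ hh : G.IsDecision i h, G.infoAt h hh = I := by
  obtain ⟨_, h, hh, rfl⟩ := I
  exact ⟨h, hh, rfl⟩

theorem infoActions_nonempty (I : G.InfoSet i) : (infoActions I).Nonempty :=
  I.2.choose_spec.1.2.1

theorem PureStrategy.choice_mem_infoActions (p : G.PureStrategy i) (I : G.InfoSet i) :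
    p.choice I ∈ infoActions I := by
  obtain ⟨h, hh, rfl⟩ := exists_infoAt_eq I
  rw [infoActions_infoAt]
  exact p.choice_mem h hh

/-- A pure strategy is a choice function on the information sets. -/
noncomputable def PureStrategy.equivPi : G.PureStrategy i ≃ ∀ I : G.InfoSet i, infoActions I where
  toFun p I := ⟨p.choice I, p.choice_mem_infoActions I⟩
  invFun φ := ⟨fun I => φ I, fun h hh => infoActions_infoAt hh ▸ (φ (G.infoAt h hh)).2⟩
  left_inv _ := rfl
  right_inv _ := rfl

open Classical in
noncomputable instance : Fintype (G.PureStrategy i) :=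
  Fintype.ofEquiv _ PureStrategy.equivPi.symm

instance : Nonempty (G.PureStrategy i) :=
  ⟨PureStrategy.equivPi.symm fun I =>
    ⟨(infoActions_nonempty I).choose, (infoActions_nonempty I).choose_spec⟩⟩

theorem sum_prod_choice (f : G.InfoSet i → Act → ℝ) :
    ∑ p : G.PureStrategy i, ∏ I, f I (p.choice I) = ∏ I, ∑ a ∈ infoActions I, f I a := by
  classical
  rw [← PureStrategy.equivPi.symm.sum_comp]
  have h := Finset.prod_univ_sum (fun I : G.InfoSet i => (Finset.univ : Finset (infoActions I)))
    (fun I a => f I a)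
  rw [Fintype.piFinset_univ] at h
  simp only [Finset.univ_eq_attach, Finset.sum_attach (infoActions _) (f _)] at h
  exact h.symm

open Classical in
/-- The choices of player `i` on the path to a node, as a partial function on the information sets
of `i`. -/
noncomputable def pathChoice (G : ExtensiveGame ι Act Info) (i : ι) :
    List Act → G.InfoSet i → Option Act
  | [] => fun _ => none
  | a :: h => if hh : G.IsDecision i h then
      Function.update (G.pathChoice i h) (G.infoAt h hh) (some a) else G.pathChoice i h

theorem exists_shorter_of_pathChoice {h : List Act} (hh : h ∈ G.nodes) {I : G.InfoSet i} {a : Act}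
    (ha : G.pathChoice i h I = some a) :
    a ∈ infoActions I ∧ ∃ h', ∃ hh' : G.IsDecision i h', G.infoAt h' hh' = I ∧
      (G.sequence i h').length < (G.sequence i h).length := by
  classical
  induction h with
  | nil => simp [pathChoice] at ha
  | cons b h ih =>
    have hn := G.parent_mem b h hh
    by_cases hd : G.IsDecision i h
    · rw [pathChoice, dif_pos hd] at ha
      rw [sequence_cons_of_isDecision hd, List.length_cons]
      by_cases hI : I = G.infoAt h hd
      · subst hI
        rw [Function.update_self, Option.some_inj] at ha
        subst ha
        exact ⟨by rw [infoActions_infoAt, mem_actions]; exact hh, h, hd, rfl, Nat.lt_succ_self _⟩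
      · rw [Function.update_of_ne hI] at ha
        obtain ⟨h1, h', hh', h2, h3⟩ := ih hn ha
        exact ⟨h1, h', hh', h2, by omega⟩
    · rw [pathChoice, dif_neg hd] at ha
      rw [sequence_cons_of_not_isDecision hh hd]
      exact ih hn ha

/-- Under perfect recall no information set is visited twice on a path. -/
theorem PerfectRecall.pathChoice_infoAt (hG : G.PerfectRecall) {h : List Act}
    (hh : G.IsDecision i h) : G.pathChoice i h (G.infoAt h hh) = none := by
  by_contra hcon
  obtain ⟨a, ha⟩ := Option.ne_none_iff_exists'.1 hcon
  obtain ⟨-, h', hh', hI, hlt⟩ := exists_shorter_of_pathChoice hh.1 ha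
  have := hG i h' h hh' hh (congrArg Subtype.val hI)
  rw [this] at hlt
  exact lt_irrefl _ hlt

theorem PerfectRecall.reach_eq_prod (hG : G.PerfectRecall) (s : G.BehaviorStrategy i)
    {h : List Act} (hh : h ∈ G.nodes) :
    s.reach h = ∏ I, (G.pathChoice i h I).elim 1 (s.prob I) := by
  classical
  induction h with
  | nil => simp [BehaviorStrategy.reach, pathChoice]
  | cons a h ih =>
    have hn := G.parent_mem a h hh
    by_cases hd : G.IsDecision i h
    · rw [s.reach_cons_of_isDecision hd, ih hn, pathChoice, dif_pos hd,
        ← Finset.mul_prod_erase _ _ (Finset.mem_univ (G.infoAt h hd)),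
        ← Finset.mul_prod_erase Finset.univ
          (fun I => (Function.update (G.pathChoice i h) (G.infoAt h hd) (some a) I).elim 1
            (s.prob I)) (Finset.mem_univ (G.infoAt h hd)),
        hG.pathChoice_infoAt hd, Function.update_self]
      simp only [Option.elim_none, Option.elim_some, one_mul]
      rw [mul_comm]
      congr 1
      refine Finset.prod_congr rfl fun I hI => ?_
      rw [Function.update_of_ne (Finset.ne_of_mem_erase hI)]
    · rw [s.reach_cons_of_not_isDecision hd, ih hn, pathChoice, dif_neg hd]

/-- Every behavior strategy is realization equivalent to a distribution over pure strategies,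
namely to independent choices at the information sets. -/
theorem PerfectRecall.exists_weights_reach (hG : G.PerfectRecall) (t : G.BehaviorStrategy i) :
    ∃ w ∈ stdSimplex ℝ (G.PureStrategy i), ∀ h ∈ G.nodes,
      t.reach h = ∑ p, w p * p.toBehavior.reach h := by
  have hsum : ∀ I, ∑ a ∈ infoActions I, t.prob I a = 1 := by
    intro I
    obtain ⟨h, hh, rfl⟩ := exists_infoAt_eq I
    rw [infoActions_infoAt]
    exact t.prob_sum h hh
  have hnonneg : ∀ I, ∀ a ∈ infoActions I, 0 ≤ t.prob I a := by
    intro I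
    obtain ⟨h, hh, rfl⟩ := exists_infoAt_eq I
    rw [infoActions_infoAt]
    exact t.prob_nonneg h hh
  refine ⟨fun p => ∏ I, t.prob I (p.choice I), ⟨fun p => Finset.prod_nonneg fun I _ =>
    hnonneg I _ (p.choice_mem_infoActions I), ?_⟩, fun h hh => ?_⟩
  · rw [sum_prod_choice]
    exact Finset.prod_eq_one fun I _ => hsum I
  · classical
    have h1 : ∀ p : G.PureStrategy i, (∏ I, t.prob I (p.choice I)) * p.toBehavior.reach h =
        ∏ I, t.prob I (p.choice I) *
          (G.pathChoice i h I).elim 1 (fun a => if p.choice I = a then 1 else 0) := by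
      intro p
      rw [hG.reach_eq_prod _ hh, ← Finset.prod_mul_distrib]
      refine Finset.prod_congr rfl fun I _ => ?_
      rcases G.pathChoice i h I with _ | a
      · rfl
      · simp [PureStrategy.toBehavior]
    simp only [h1]
    rw [sum_prod_choice (fun I b => t.prob I b *
      (G.pathChoice i h I).elim 1 (fun a => if b = a then 1 else 0)), hG.reach_eq_prod _ hh]
    refine Finset.prod_congr rfl fun I _ => ?_
    rcases hp : G.pathChoice i h I with _ | a
    · simp [hsum I]
    · have := (exists_shorter_of_pathChoice hh hp).1
      simp [this]

/-- Some pure strategy of a player reaches a given node. -/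
theorem PerfectRecall.exists_pure_reach_eq_one (hG : G.PerfectRecall) {h : List Act}
    (hh : h ∈ G.nodes) : ∃ p : G.PureStrategy i, p.toBehavior.reach h = 1 := by
  classical
  obtain ⟨p₀⟩ := (inferInstance : Nonempty (G.PureStrategy i))
  have hmem : ∀ I, (G.pathChoice i h I).getD (p₀.choice I) ∈ infoActions I := by
    intro I
    rcases hp : G.pathChoice i h I with _ | a
    · exact p₀.choice_mem_infoActions I
    · exact (exists_shorter_of_pathChoice hh hp).1
  refine ⟨PureStrategy.equivPi.symm fun I => ⟨_, hmem I⟩, ?_⟩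
  rw [hG.reach_eq_prod _ hh]
  refine Finset.prod_eq_one fun I _ => ?_
  rcases hp : G.pathChoice i h I with _ | a
  · rfl
  · simp [PureStrategy.toBehavior, PureStrategy.equivPi, hp]

/-- The reach probability of a node depends only on the sequence of the player at the node. -/
theorem BehaviorStrategy.reach_congr (s : G.BehaviorStrategy i) {h h' : List Act}
    (hh : h ∈ G.nodes) (hh' : h' ∈ G.nodes) (heq : G.sequence i h = G.sequence i h') :
    s.reach h = s.reach h' := by
  classical
  have key : ∀ h ∈ G.nodes, s.reach h = ((G.sequence i h).map fun x =>
      if hI : ∃ h, G.IsDecision i h ∧ G.info h = x.1 then s.prob ⟨x.1, hI⟩ x.2 else 1).prod := by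
    intro h hh
    induction h with
    | nil => simp [reach, sequence]
    | cons a h ih =>
      by_cases hd : G.IsDecision i h
      · rw [s.reach_cons_of_isDecision hd, sequence_cons_of_isDecision hd, List.map_cons,
          List.prod_cons, ← ih (G.parent_mem a h hh), mul_comm,
          dif_pos (show ∃ h', G.IsDecision i h' ∧ G.info h' = G.info h from ⟨h, hd, rfl⟩)]
        rfl
      · rw [s.reach_cons_of_not_isDecision hd, sequence_cons_of_not_isDecision hh hd,
          ih (G.parent_mem a h hh)]
  rw [key h hh, key h' hh', heq]

theorem BehaviorStrategy.reach_nonneg (s : G.BehaviorStrategy i) {h : List Act}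
    (hh : h ∈ G.nodes) : 0 ≤ s.reach h := by
  induction h with
  | nil => simp [reach]
  | cons a h ih =>
    have hn := G.parent_mem a h hh
    by_cases hd : G.IsDecision i h
    · rw [s.reach_cons_of_isDecision hd]
      exact mul_nonneg (ih hn) (s.prob_nonneg h hd a (mem_actions.2 hh))
    · rw [s.reach_cons_of_not_isDecision hd]
      exact ih hn

theorem BehaviorStrategy.sum_reach_cons (s : G.BehaviorStrategy i) {h : List Act}
    (hd : G.IsDecision i h) : ∑ a ∈ G.actions h, s.reach (a :: h) = s.reach h := by
  simp only [s.reach_cons_of_isDecision hd]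
  rw [← Finset.mul_sum, s.prob_sum h hd, mul_one]

theorem PureStrategy.reach_eq_zero_or_one (p : G.PureStrategy i) (h : List Act) :
    p.toBehavior.reach h = 0 ∨ p.toBehavior.reach h = 1 := by
  induction h with
  | nil => simp [BehaviorStrategy.reach]
  | cons a h ih =>
    by_cases hd : G.IsDecision i h
    · rw [BehaviorStrategy.reach_cons_of_isDecision _ hd]
      simp only [PureStrategy.toBehavior] at ih ⊢
      split_ifs
      · simpa using ih
      · simp
    · rw [BehaviorStrategy.reach_cons_of_not_isDecision _ hd]
      exact ih

theorem MixedStrategy.reach_eq_sum (m : G.MixedStrategy i) (h : List Act) :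
    m.reach h = ∑ p, m.weight p * p.toBehavior.reach h :=
  Finset.sum_subset (Finset.subset_univ _) fun p _ hp => by
    rw [Finsupp.notMem_support_iff.1 hp, zero_mul]

theorem MixedStrategy.reach_nonneg (m : G.MixedStrategy i) {h : List Act} (hh : h ∈ G.nodes) :
    0 ≤ m.reach h :=
  Finset.sum_nonneg fun p _ => mul_nonneg (m.weight_nonneg p) (p.toBehavior.reach_nonneg hh)

theorem MixedStrategy.sum_reach_cons (m : G.MixedStrategy i) {h : List Act}
    (hd : G.IsDecision i h) : ∑ a ∈ G.actions h, m.reach (a :: h) = m.reach h := by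
  simp only [reach]
  rw [Finset.sum_comm]
  refine Finset.sum_congr rfl fun p _ => ?_
  rw [← Finset.mul_sum, p.toBehavior.sum_reach_cons hd]

theorem MixedStrategy.reach_congr (m : G.MixedStrategy i) {h h' : List Act}
    (hh : h ∈ G.nodes) (hh' : h' ∈ G.nodes) (heq : G.sequence i h = G.sequence i h') :
    m.reach h = m.reach h' :=
  Finset.sum_congr rfl fun p _ => by rw [p.toBehavior.reach_congr hh hh' heq]

/-- Kuhn's theorem: under perfect recall every mixed strategy is realization equivalent to the
behavior strategy of its conditional action probabilities. -/
theorem PerfectRecall.exists_realizationEquivalent (hG : G.PerfectRecall)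
    (m : G.MixedStrategy i) : ∃ s : G.BehaviorStrategy i, G.RealizationEquivalent s m := by
  classical
  obtain ⟨p₀⟩ := (inferInstance : Nonempty (G.PureStrategy i))
  -- at information sets that `m` does not reach, any distribution serves
  let f : G.InfoSet i → Act → ℝ := fun I a =>
    if m.reach I.2.choose = 0 then (if p₀.choice I = a then 1 else 0)
    else m.reach (a :: I.2.choose) / m.reach I.2.choose
  have hf : ∀ h (hh : G.IsDecision i h), ∀ a ∈ G.actions h, f (G.infoAt h hh) a =
      if m.reach h = 0 then (if p₀.choice (G.infoAt h hh) = a then 1 else 0)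
      else m.reach (a :: h) / m.reach h := by
    intro h hh a ha
    have hc := (G.infoAt h hh).2.choose_spec
    have hseq := hG i _ h hc.1 hh hc.2
    have ha' : a ∈ G.actions (G.infoAt h hh).2.choose := by
      rw [← infoActions_infoAt hh] at ha
      exact ha
    have h1 := m.reach_congr hc.1.1 hh.1 hseq
    have h2 := m.reach_congr (mem_actions.1 ha') (mem_actions.1 ha) (by
      rw [sequence_cons_of_isDecision hc.1, sequence_cons_of_isDecision hh, hseq, hc.2]
      rfl)
    simp only [f]
    rw [h1, h2]
  let s : G.BehaviorStrategy i :=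
    { prob := f
      prob_nonneg := fun h hh a ha => by
        rw [hf h hh a ha]
        split_ifs
        · exact zero_le_one
        · exact le_rfl
        · exact div_nonneg (m.reach_nonneg (mem_actions.1 ha)) (m.reach_nonneg hh.1)
      prob_sum := fun h hh => by
        rw [Finset.sum_congr rfl (hf h hh)]
        split_ifs with h0
        · rw [Finset.sum_ite_eq, if_pos (p₀.choice_mem h hh)]
        · rw [← Finset.sum_div, m.sum_reach_cons hh, div_self h0] }
  refine ⟨s, fun h hh => ?_⟩
  induction h with
  | nil =>
    have := m.weight_sum
    simp [BehaviorStrategy.reach, MixedStrategy.reach, this]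
  | cons a h ih =>
    have hn := G.parent_mem a h hh
    have ha := mem_actions.2 hh
    by_cases hd : G.IsDecision i h
    · rw [s.reach_cons_of_isDecision hd, ih hn]
      change m.reach h * f _ a = _
      rw [hf h hd a ha]
      by_cases h0 : m.reach h = 0
      · have hle := Finset.single_le_sum (f := fun a => m.reach (a :: h))
          (fun b hb => m.reach_nonneg (mem_actions.1 hb)) ha
        rw [m.sum_reach_cons hd, h0] at hle
        rw [h0, zero_mul]
        exact le_antisymm (m.reach_nonneg hh) hle
      · rw [if_neg h0, mul_div_cancel₀ _ h0]
    · rw [s.reach_cons_of_not_isDecision hd, ih hn]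
      exact Finset.sum_congr rfl fun p _ => by
        rw [p.toBehavior.reach_cons_of_not_isDecision hd]

/-- A function on the nodes that is conserved at every decision has its root value as total over
the leaves. -/
theorem sum_terminals_eq (G : ExtensiveGame ι Act Info) {W : List Act → ℝ}
    (hW : ∀ h ∈ G.nodes, (G.actions h).Nonempty → ∑ a ∈ G.actions h, W (a :: h) = W h) :
    ∑ z ∈ G.terminals, W z = W [] := by
  classical
  have h1 : ∑ h ∈ G.nodes.filter (fun h => (G.actions h).Nonempty), ∑ a ∈ G.actions h, W (a :: h) =
      ∑ h ∈ G.nodes.erase [], W h := by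
    rw [Finset.sum_sigma']
    refine Finset.sum_bij (fun x _ => x.2 :: x.1) ?_ ?_ ?_ ?_
    · rintro ⟨h, a⟩ hx
      exact Finset.mem_erase.2 ⟨by simp, mem_actions.1 (Finset.mem_sigma.1 hx).2⟩
    · rintro ⟨h, a⟩ - ⟨h', a'⟩ - heq
      obtain ⟨rfl, rfl⟩ := List.cons.inj heq
      rfl
    · rintro (_ | ⟨a, h⟩) hx
      · simp at hx
      · have hx := Finset.mem_of_mem_erase hx
        exact ⟨⟨h, a⟩, Finset.mem_sigma.2 ⟨Finset.mem_filter.2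
          ⟨G.parent_mem a h hx, ⟨a, mem_actions.2 hx⟩⟩, mem_actions.2 hx⟩, rfl⟩
    · intros
      rfl
  have h2 : ∑ h ∈ G.nodes.filter (fun h => (G.actions h).Nonempty), ∑ a ∈ G.actions h, W (a :: h) =
      ∑ h ∈ G.nodes.filter (fun h => (G.actions h).Nonempty), W h :=
    Finset.sum_congr rfl fun h hh =>
      hW h (Finset.mem_filter.1 hh).1 (Finset.mem_filter.1 hh).2
  have h3 := Finset.sum_filter_add_sum_filter_not G.nodes (fun h => (G.actions h).Nonempty) W
  have h4 := Finset.add_sum_erase G.nodes W G.root_mem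
  rw [terminals]
  linarith

theorem chanceReach_nonneg (G : ExtensiveGame ι Act Info) {h : List Act} (hh : h ∈ G.nodes) :
    0 ≤ G.chanceReach h := by
  induction h with
  | nil => simp [chanceReach]
  | cons a h ih =>
    have hn := G.parent_mem a h hh
    have ha := mem_actions.2 hh
    rw [chanceReach]
    refine mul_nonneg (ih hn) ?_
    split_ifs with ht
    · exact G.chance_nonneg h hn ⟨a, ha⟩ ht a ha
    · exact zero_le_one

theorem sum_chanceReach_mul_prod_reach [Fintype ι] (s : ∀ j, G.BehaviorStrategy j) :
    ∑ z ∈ G.terminals, G.chanceReach z * ∏ j, (s j).reach z = 1 := by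
  classical
  rw [G.sum_terminals_eq (W := fun z => G.chanceReach z * ∏ j, (s j).reach z)]
  · simp [chanceReach, BehaviorStrategy.reach]
  intro h hh hne
  rcases ht : G.turn h with _ | i
  · have hd : ∀ j, ¬ G.IsDecision j h := fun j hj => by
      have := hj.2.2
      rw [ht] at this
      cases this
    simp only [(s _).reach_cons_of_not_isDecision (hd _), chanceReach, if_pos ht]
    rw [← Finset.sum_mul, ← Finset.mul_sum,
      show ∑ a ∈ G.actions h, G.chance h a = 1 from G.chance_sum h hh hne ht, mul_one]
  · have hd : G.IsDecision i h := ⟨hh, hne, ht⟩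
    have hd' : ∀ j ∈ Finset.univ.erase i, ¬ G.IsDecision j h := fun j hj hdj => by
      have := hdj.2.2
      rw [ht, Option.some_inj] at this
      exact Finset.ne_of_mem_erase hj this.symm
    have hc : ∀ a, G.chanceReach (a :: h) = G.chanceReach h := fun a => by
      simp [chanceReach, ht]
    have hprod : ∀ a, ∏ j, (s j).reach (a :: h) =
        (s i).reach (a :: h) * ∏ j ∈ Finset.univ.erase i, (s j).reach h := fun a => by
      rw [← Finset.mul_prod_erase _ _ (Finset.mem_univ i)]
      congr 1
      exact Finset.prod_congr rfl fun j hj => (s j).reach_cons_of_not_isDecision (hd' j hj) a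
    simp only [hc, hprod]
    rw [← Finset.mul_sum, ← Finset.sum_mul, (s i).sum_reach_cons hd,
      Finset.mul_prod_erase _ (fun j => (s j).reach h) (Finset.mem_univ i)]

end ExtensiveGame

/-! ### Sparse approximate equilibria -/

namespace ExtensiveGame

section TwoPlayers

variable {Act Info : Type*} {G : ExtensiveGame (Fin 2) Act Info} {i j : Fin 2}

/-- The expected payoff of player `i` when `i` reaches the nodes with probabilities `r` and the
opponent with probabilities `r'`. -/
noncomputable def payoff (G : ExtensiveGame (Fin 2) Act Info) (i : Fin 2) (r r' : List Act → ℝ) :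
    ℝ :=
  ∑ z ∈ G.terminals, G.chanceReach z * (r z * r' z) * G.utility i z

open Classical in
/-- The part of the expected payoff of player `i` that comes from the leaves with sequence `q`
of `i`, when `i` plays to reach them and the opponent reaches the nodes with probabilities `r`. -/
noncomputable def seqPayoff (G : ExtensiveGame (Fin 2) Act Info) (i : Fin 2)
    (q : List (Info × Act)) (r : List Act → ℝ) : ℝ :=
  ∑ z ∈ G.terminals.filter (fun z => G.sequence i z = q), G.chanceReach z * r z * G.utility i z

theorem mem_nodes_of_mem_terminals {ι : Type*} {G : ExtensiveGame ι Act Info} {z : List Act}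
    (hz : z ∈ G.terminals) : z ∈ G.nodes :=
  (Finset.mem_filter.1 hz).1

theorem prod_fin_two_of_ne (hij : i ≠ j) (f : Fin 2 → ℝ) : ∏ k, f k = f i * f j := by
  rw [← Finset.prod_pair hij]
  congr 1
  ext k
  simp only [Finset.mem_univ, Finset.mem_insert, Finset.mem_singleton, true_iff]
  omega

theorem value_eq_payoff (hij : i ≠ j) (s : ∀ k, G.BehaviorStrategy k) :
    G.value s i = G.payoff i (s i).reach (s j).reach := by
  simp only [value, payoff, prod_fin_two_of_ne hij]

theorem payoff_congr {r₁ r₂ r₁' r₂' : List Act → ℝ} (h : ∀ z ∈ G.nodes, r₁ z = r₂ z)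
    (h' : ∀ z ∈ G.nodes, r₁' z = r₂' z) : G.payoff i r₁ r₁' = G.payoff i r₂ r₂' :=
  Finset.sum_congr rfl fun z hz => by
    rw [h z (mem_nodes_of_mem_terminals hz), h' z (mem_nodes_of_mem_terminals hz)]

theorem payoff_sum_left {P : Type*} [Fintype P] (w : P → ℝ) (r : P → List Act → ℝ)
    (r' : List Act → ℝ) :
    G.payoff i (fun z => ∑ p, w p * r p z) r' = ∑ p, w p * G.payoff i (r p) r' := by
  simp only [payoff, Finset.mul_sum, Finset.sum_mul]
  rw [Finset.sum_comm]
  exact Finset.sum_congr rfl fun _ _ => Finset.sum_congr rfl fun _ _ => by ring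

theorem payoff_sum_right {P : Type*} [Fintype P] (w : P → ℝ) (r : List Act → ℝ)
    (r' : P → List Act → ℝ) :
    G.payoff i r (fun z => ∑ p, w p * r' p z) = ∑ p, w p * G.payoff i r (r' p) := by
  simp only [payoff, Finset.mul_sum, Finset.sum_mul]
  rw [Finset.sum_comm]
  exact Finset.sum_congr rfl fun _ _ => Finset.sum_congr rfl fun _ _ => by ring

theorem seqPayoff_sum {P : Type*} [Fintype P] (q : List (Info × Act)) (w : P → ℝ)
    (r : P → List Act → ℝ) :
    G.seqPayoff i q (fun z => ∑ p, w p * r p z) = ∑ p, w p * G.seqPayoff i q (r p) := by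
  simp only [seqPayoff, Finset.mul_sum, Finset.sum_mul]
  rw [Finset.sum_comm]
  exact Finset.sum_congr rfl fun _ _ => Finset.sum_congr rfl fun _ _ => by ring

open Classical in
/-- Chance and the opponent spread at most unit mass over the leaves with a given sequence of
player `i`: a pure strategy of `i` that plays towards one of them reaches all of them. -/
theorem PerfectRecall.sum_chanceReach_mul_reach_le_one (hG : G.PerfectRecall) (hij : i ≠ j)
    (q : List (Info × Act)) (t : G.BehaviorStrategy j) :
    ∑ z ∈ G.terminals.filter (fun z => G.sequence i z = q), G.chanceReach z * t.reach z ≤ 1 := by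
  rcases (G.terminals.filter (fun z => G.sequence i z = q)).eq_empty_or_nonempty with h0 | ⟨z₀, hmem⟩
  · rw [h0]; simp
  obtain ⟨hz₀, hq₀⟩ := Finset.mem_filter.1 hmem
  subst hq₀
  obtain ⟨p, hp⟩ := hG.exists_pure_reach_eq_one (i := i) (mem_nodes_of_mem_terminals hz₀)
  obtain ⟨s, hsi, hsj⟩ : ∃ s : ∀ k, G.BehaviorStrategy k, s i = p.toBehavior ∧ s j = t := by
    refine ⟨Function.update (Function.update
      (fun k => (Classical.arbitrary (G.PureStrategy k)).toBehavior) i p.toBehavior) j t, ?_, ?_⟩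
    · rw [Function.update_of_ne hij, Function.update_self]
    · rw [Function.update_self]
  rw [← sum_chanceReach_mul_prod_reach s]
  simp only [prod_fin_two_of_ne hij, hsi, hsj]
  calc ∑ z ∈ G.terminals.filter (fun z => G.sequence i z = G.sequence i z₀),
        G.chanceReach z * t.reach z
      = ∑ z ∈ G.terminals.filter (fun z => G.sequence i z = G.sequence i z₀),
        G.chanceReach z * (p.toBehavior.reach z * t.reach z) :=
        Finset.sum_congr rfl fun z hz => by
          obtain ⟨hz, hq⟩ := Finset.mem_filter.1 hz
          rw [p.toBehavior.reach_congr (mem_nodes_of_mem_terminals hz)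
            (mem_nodes_of_mem_terminals hz₀) hq, hp, one_mul]
    _ ≤ _ := Finset.sum_le_sum_of_subset_of_nonneg (Finset.filter_subset _ _) fun z hz _ => by
        have hz := mem_nodes_of_mem_terminals hz
        exact mul_nonneg (G.chanceReach_nonneg hz)
          (mul_nonneg (p.toBehavior.reach_nonneg hz) (t.reach_nonneg hz))

theorem PerfectRecall.abs_seqPayoff_le (hG : G.PerfectRecall) (hij : i ≠ j) {M : ℝ} (hM0 : 0 ≤ M)
    (hM : ∀ z ∈ G.terminals, |G.utility i z| ≤ M) (q : List (Info × Act))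
    (t : G.BehaviorStrategy j) : |G.seqPayoff i q t.reach| ≤ M := by
  classical
  refine (Finset.abs_sum_le_sum_abs _ _).trans ?_
  calc ∑ z ∈ G.terminals.filter (fun z => G.sequence i z = q),
        |G.chanceReach z * t.reach z * G.utility i z|
      ≤ ∑ z ∈ G.terminals.filter (fun z => G.sequence i z = q),
        G.chanceReach z * t.reach z * M := Finset.sum_le_sum fun z hz => by
          have hz' := (Finset.mem_filter.1 hz).1
          have hn := mem_nodes_of_mem_terminals hz'
          have h0 := mul_nonneg (G.chanceReach_nonneg hn) (t.reach_nonneg hn)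
          rw [abs_mul, abs_of_nonneg h0]
          exact mul_le_mul_of_nonneg_left (hM z hz') h0
    _ ≤ 1 * M := by
        rw [← Finset.sum_mul]
        exact mul_le_mul_of_nonneg_right (hG.sum_chanceReach_mul_reach_le_one hij q t) hM0
    _ = M := one_mul M

/-- The payoff of a pure strategy is the sum of the contributions of the terminal sequences in its
support. -/
theorem payoff_pure_eq_sum_seqPayoff (p : G.PureStrategy i) {Q : Finset (List (Info × Act))}
    (hQ : (Q : Set (List (Info × Act))) = G.supportSequences p) (r : List Act → ℝ) :
    G.payoff i p.toBehavior.reach r = ∑ q ∈ Q, G.seqPayoff i q r := by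
  classical
  have hmem : ∀ q, q ∈ Q ↔ ∃ z, (z ∈ G.terminals ∧ 0 < p.toBehavior.reach z) ∧
      G.sequence i z = q := fun q => by
    rw [← Finset.mem_coe, hQ]
    rfl
  have hone : ∀ z, 0 < p.toBehavior.reach z → p.toBehavior.reach z = 1 := fun z hz =>
    (p.reach_eq_zero_or_one z).resolve_left hz.ne'
  have h1 : G.payoff i p.toBehavior.reach r =
      ∑ z ∈ G.terminals.filter (fun z => 0 < p.toBehavior.reach z),
        G.chanceReach z * r z * G.utility i z := by
    rw [Finset.sum_filter]
    refine Finset.sum_congr rfl fun z _ => ?_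
    split_ifs with hz
    · rw [hone z hz, one_mul]
    · rw [(p.reach_eq_zero_or_one z).resolve_right fun h => hz (h ▸ one_pos)]
      ring
  rw [h1, ← Finset.sum_fiberwise_of_maps_to (t := Q) (g := G.sequence i)]
  · refine Finset.sum_congr rfl fun q hq => ?_
    rw [seqPayoff]
    refine Finset.sum_congr ?_ fun _ _ => rfl
    ext z
    simp only [Finset.mem_filter]
    constructor
    · rintro ⟨⟨h1, -⟩, h2⟩
      exact ⟨h1, h2⟩
    · rintro ⟨h1, h2⟩
      obtain ⟨z', ⟨h3, h4⟩, h5⟩ := (hmem q).1 hq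
      refine ⟨⟨h1, ?_⟩, h2⟩
      rwa [p.toBehavior.reach_congr (mem_nodes_of_mem_terminals h1)
        (mem_nodes_of_mem_terminals h3) (h2.trans h5.symm)]
  · intro z hz
    exact (hmem _).2 ⟨z, Finset.mem_filter.1 hz, rfl⟩

theorem finite_supportSequences {ι : Type*} {G : ExtensiveGame ι Act Info} {i : ι}
    (p : G.PureStrategy i) : (G.supportSequences p).Finite :=
  (G.terminals.finite_toSet.subset fun _ hz => hz.1).image _

theorem supportSequences_nonempty {ι : Type*} [Fintype ι] {G : ExtensiveGame ι Act Info} {i : ι}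
    (p : G.PureStrategy i) : (G.supportSequences p).Nonempty := by
  classical
  have h := sum_chanceReach_mul_prod_reach (G := G) (Function.update
    (fun k => (Classical.arbitrary (G.PureStrategy k)).toBehavior) i p.toBehavior)
  obtain ⟨z, hz, hne⟩ := Finset.exists_ne_zero_of_sum_ne_zero (h.trans_ne one_ne_zero)
  have h1 := Finset.prod_ne_zero_iff.1 (right_ne_zero_of_mul hne) i (Finset.mem_univ i)
  rw [Function.update_self] at h1
  exact ⟨_, z, ⟨hz, lt_of_le_of_ne
    (p.toBehavior.reach_nonneg (mem_nodes_of_mem_terminals hz)) h1.symm⟩, rfl⟩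

/-- The uniform distribution on `k` pure strategies, repetitions allowed. -/
theorem MixedStrategy.exists_uniform {ι : Type*} {G : ExtensiveGame ι Act Info} {i : ι} {k : ℕ}
    (hk : 0 < k) (q : Fin k → G.PureStrategy i) :
    ∃ m : G.MixedStrategy i, m.weight.support.card ≤ k ∧
      (∀ p, 0 < m.weight p → ∃ l, q l = p) ∧
      ∀ f : G.PureStrategy i → ℝ, ∑ p, m.weight p * f p = (∑ l, f (q l)) / k := by
  classical
  let w : G.PureStrategy i →₀ ℝ :=
    Finsupp.equivFunOnFinite.symm fun p => ∑ l, if q l = p then (1 / k : ℝ) else 0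
  have hw : ∀ p, w p = ∑ l, if q l = p then (1 / k : ℝ) else 0 := fun p => rfl
  have hsum : ∀ f : G.PureStrategy i → ℝ, ∑ p, w p * f p = (∑ l, f (q l)) / k := by
    intro f
    simp only [hw, Finset.sum_mul, ite_mul, zero_mul]
    rw [Finset.sum_comm, Finset.sum_div]
    refine Finset.sum_congr rfl fun l _ => ?_
    rw [Finset.sum_ite_eq, if_pos (Finset.mem_univ _)]
    ring
  have hsupp : ∀ p, w p ≠ 0 → ∃ l, q l = p := by
    intro p hp
    rw [hw] at hp
    obtain ⟨l, -, hl⟩ := Finset.exists_ne_zero_of_sum_ne_zero hp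
    exact ⟨l, by by_contra h; simp [h] at hl⟩
  have hk' : (k : ℝ) ≠ 0 := by exact_mod_cast hk.ne'
  refine ⟨⟨w, fun p => ?_, ?_⟩, ?_, fun p hp => hsupp p hp.ne', hsum⟩
  · rw [hw]
    exact Finset.sum_nonneg fun l _ => by split_ifs <;> positivity
  · rw [Finset.sum_subset (Finset.subset_univ w.support) fun p _ hp =>
      Finsupp.notMem_support_iff.1 hp]
    have := hsum fun _ => 1
    simpa [hk'] using this
  · calc w.support.card ≤ (Finset.univ.image q).card := Finset.card_le_card fun p hp => by
          obtain ⟨l, hl⟩ := hsupp p (Finsupp.mem_support_iff.1 hp)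
          exact Finset.mem_image.2 ⟨l, Finset.mem_univ _, hl⟩
      _ ≤ k := Finset.card_image_le.trans (by simp)

/-- Sampling from a mixture `w` of pure strategies of `j`: a uniform distribution on `k` of them
gives every pure strategy of the opponent `i` nearly the same payoff as `w`. The error of a pure
strategy is at most `D` times that of a terminal sequence, so that it suffices to control as many
quantities as there are terminal sequences. -/
theorem PerfectRecall.exists_sparse_mixed (hG : G.PerfectRecall) (hij : i ≠ j) {M ε : ℝ}
    (hM0 : 0 < M) (hM : ∀ z ∈ G.terminals, |G.utility i z| ≤ M) (hε : 0 < ε) {D : ℕ} (hD : 0 < D)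
    (hDle : ∀ p : G.PureStrategy i, (G.supportSequences p).ncard ≤ D)
    {w : G.PureStrategy j → ℝ} (hw : w ∈ stdSimplex ℝ (G.PureStrategy j)) {k : ℕ} (hk : 0 < k)
    (hk' : 32 * M ^ 2 * D ^ 2 / ε ^ 2 * Real.log (2 * G.nodes.card) ≤ k) :
    ∃ m : G.MixedStrategy j, m.weight.support.card ≤ k ∧ (∀ p, 0 < m.weight p → 0 < w p) ∧
      ∀ p : G.PureStrategy i, |G.payoff i p.toBehavior.reach m.reach -
        ∑ q, w q * G.payoff i p.toBehavior.reach q.toBehavior.reach| ≤ ε / 2 := by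
  classical
  obtain ⟨hw0, hw1⟩ := hw
  let J := {q // q ∈ G.terminals.image (G.sequence i)}
  have hJ : Fintype.card J ≤ G.nodes.card := by
    rw [Fintype.card_coe]
    exact Finset.card_image_le.trans (Finset.card_le_card (Finset.filter_subset _ _))
  have hDpos : (0 : ℝ) < D := by exact_mod_cast hD
  have hN : (0 : ℝ) < G.nodes.card := by
    exact_mod_cast Finset.card_pos.2 ⟨[], G.root_mem⟩
  have hlog : Real.log (2 * Fintype.card J) ≤ Real.log (2 * G.nodes.card) := by
    rcases Nat.eq_zero_or_pos (Fintype.card J) with h0 | h0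
    · rw [h0]
      simp only [Nat.cast_zero, mul_zero, Real.log_zero]
      have h1 : (1 : ℝ) ≤ G.nodes.card := by
        exact_mod_cast Finset.card_pos.2 ⟨[], G.root_mem⟩
      exact Real.log_nonneg (by linarith)
    · have h1 : (0 : ℝ) < Fintype.card J := by exact_mod_cast h0
      exact Real.log_le_log (by positivity) (by
        have : (Fintype.card J : ℝ) ≤ G.nodes.card := by exact_mod_cast hJ
        linarith)
  have hbound : ∀ (s : J) (p : G.PureStrategy j), |G.seqPayoff i s.1 p.toBehavior.reach| ≤ M :=
    fun s p => hG.abs_seqPayoff_le hij hM0.le hM s.1 p.toBehavior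
  obtain ⟨q, hq, hclose⟩ := exists_sample_abs_sub_le hw0 hw1
    (fun (s : J) (p : G.PureStrategy j) => G.seqPayoff i s.1 p.toBehavior.reach)
    (a := 2 * M) (δ := ε / (2 * D)) (by positivity) (by positivity)
    (fun s p => by
      have h1 : |∑ p', w p' * G.seqPayoff i s.1 p'.toBehavior.reach| ≤ M := by
        refine (Finset.abs_sum_le_sum_abs _ _).trans ?_
        calc ∑ p', |w p' * G.seqPayoff i s.1 p'.toBehavior.reach| ≤ ∑ p', w p' * M :=
              Finset.sum_le_sum fun p' _ => by
                rw [abs_mul, abs_of_nonneg (hw0 p')]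
                exact mul_le_mul_of_nonneg_left (hbound s p') (hw0 p')
          _ = M := by rw [← Finset.sum_mul, hw1, one_mul]
      refine (abs_sub _ _).trans ?_
      linarith [hbound s p])
    hk (by
      rw [div_pow, mul_div_assoc', le_div_iff₀ (by positivity)]
      rw [div_mul_eq_mul_div, div_le_iff₀ (by positivity)] at hk'
      refine le_trans ?_ hk'
      have := mul_le_mul_of_nonneg_left hlog (show 0 ≤ 32 * M ^ 2 * (D : ℝ) ^ 2 by positivity)
      refine le_trans (le_of_eq ?_) this
      ring)
  obtain ⟨m, hmk, hmq, hmsum⟩ := MixedStrategy.exists_uniform hk q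
  refine ⟨m, hmk, fun p hp => ?_, fun p => ?_⟩
  · obtain ⟨l, rfl⟩ := hmq p hp
    exact hq l
  have hmreach : m.reach = fun z => ∑ p, m.weight p * p.toBehavior.reach z :=
    funext m.reach_eq_sum
  set Q := (finite_supportSequences p).toFinset with hQdef
  have hQ : (Q : Set (List (Info × Act))) = G.supportSequences p := by simp [hQdef]
  have hQcard : Q.card ≤ D := by
    rw [hQdef, ← Set.ncard_eq_toFinset_card _ (finite_supportSequences p)]
    exact hDle p
  rw [← payoff_sum_right, payoff_pure_eq_sum_seqPayoff p hQ, payoff_pure_eq_sum_seqPayoff p hQ,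
    ← Finset.sum_sub_distrib]
  refine (Finset.abs_sum_le_sum_abs _ _).trans ?_
  calc ∑ x ∈ Q, |G.seqPayoff i x m.reach -
          G.seqPayoff i x (fun z => ∑ q, w q * q.toBehavior.reach z)|
      ≤ ∑ x ∈ Q, ε / (2 * D) := Finset.sum_le_sum fun x hx => by
        obtain ⟨z, ⟨hz, -⟩, hzx⟩ : x ∈ G.supportSequences p := hQ ▸ Finset.mem_coe.2 hx
        have := hclose ⟨x, Finset.mem_image.2 ⟨z, hz, hzx⟩⟩
        rwa [← hmsum fun p => G.seqPayoff i x p.toBehavior.reach, ← seqPayoff_sum, ← hmreach,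
          ← seqPayoff_sum] at this
    _ = Q.card * (ε / (2 * D)) := by rw [Finset.sum_const, nsmul_eq_mul]
    _ ≤ D * (ε / (2 * D)) := mul_le_mul_of_nonneg_right (by exact_mod_cast hQcard) (by positivity)
    _ = ε / 2 := by field_simp

/-- Sampling `k` pure strategies of each player from an exact equilibrium of the normal form gives
an `ε`-equilibrium. The sampled strategies of a player are best responses to the exact strategy of
the opponent, hence nearly best responses to the sampled one, so the two samples can be chosen
independently. -/
theorem PerfectRecall.exists_isNash_sparse (hG : G.PerfectRecall) {M ε : ℝ}
    (hM0 : 0 < M) (hM : ∀ i, ∀ z ∈ G.terminals, |G.utility i z| ≤ M) (hε : 0 < ε) {D : ℕ}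
    (hD : 0 < D) (hDle : ∀ (i : Fin 2) (p : G.PureStrategy i), (G.supportSequences p).ncard ≤ D)
    {k : ℕ} (hk : 0 < k)
    (hk' : 32 * M ^ 2 * D ^ 2 / ε ^ 2 * Real.log (2 * G.nodes.card) ≤ k) :
    ∃ s : ∀ i, G.BehaviorStrategy i, G.IsNash ε s ∧
      ∀ i, ∃ m : G.MixedStrategy i, G.RealizationEquivalent (s i) m ∧
        m.weight.support.card ≤ k := by
  obtain ⟨x₀, hx₀, x₁, hx₁, hbest₀, hbest₁⟩ := exists_bimatrix_equilibrium
    (fun (p : G.PureStrategy 0) (q : G.PureStrategy 1) =>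
      G.payoff 0 p.toBehavior.reach q.toBehavior.reach)
    (fun (q : G.PureStrategy 1) (p : G.PureStrategy 0) =>
      G.payoff 1 q.toBehavior.reach p.toBehavior.reach)
  obtain ⟨x, hx, hbest⟩ : ∃ x : ∀ i, G.PureStrategy i → ℝ,
      (∀ i, x i ∈ stdSimplex ℝ (G.PureStrategy i)) ∧
      ∀ i j, i ≠ j → ∀ p, 0 < x i p → ∀ p' : G.PureStrategy i,
        ∑ q, x j q * G.payoff i p'.toBehavior.reach q.toBehavior.reach ≤
          ∑ q, x j q * G.payoff i p.toBehavior.reach q.toBehavior.reach := by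
    refine ⟨Fin.cons x₀ (Fin.cons x₁ finZeroElim), ?_, ?_⟩
    · rw [Fin.forall_fin_two]
      exact ⟨hx₀, hx₁⟩
    · simp only [Fin.forall_fin_two]
      exact ⟨⟨fun h => absurd rfl h, fun _ => hbest₀⟩, ⟨fun _ => hbest₁, fun h => absurd rfl h⟩⟩
  have hsparse : ∀ j, ∃ m : G.MixedStrategy j, m.weight.support.card ≤ k ∧
      (∀ p, 0 < m.weight p → 0 < x j p) ∧ ∀ i, i ≠ j → ∀ p : G.PureStrategy i,
        |G.payoff i p.toBehavior.reach m.reach -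
          ∑ q, x j q * G.payoff i p.toBehavior.reach q.toBehavior.reach| ≤ ε / 2 := by
    intro j
    obtain ⟨i, hij⟩ := exists_ne j
    obtain ⟨m, h1, h2, h3⟩ :=
      hG.exists_sparse_mixed hij hM0 (hM i) hε hD (hDle i) (hx j) hk hk'
    refine ⟨m, h1, h2, fun i' hi' => ?_⟩
    obtain rfl : i' = i := by omega
    exact h3
  choose m hcard hsupp hclose using hsparse
  choose s hs using fun i => hG.exists_realizationEquivalent (m i)
  refine ⟨s, fun i t => ?_, fun i => ⟨m i, hs i, hcard i⟩⟩
  obtain ⟨j, hji⟩ := exists_ne i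
  have hij := hji.symm
  obtain ⟨w, ⟨hw0, hw1⟩, hw⟩ := hG.exists_weights_reach t
  have hm1 : ∑ p, (m i).weight p = 1 := by
    rw [← (m i).weight_sum]
    exact (Finset.sum_subset (Finset.subset_univ _) fun p _ hp =>
      Finsupp.notMem_support_iff.1 hp).symm
  obtain ⟨p₀, hp₀, -⟩ := exists_pos_weight_le (f := fun _ => 0) (b := 0) (hx i).1 (hx i).2 (by simp)
  set V := ∑ q, x j q * G.payoff i p₀.toBehavior.reach q.toBehavior.reach
  -- all pure strategies of `i` get at most `V + ε / 2` against `m j`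
  have hupper : G.payoff i t.reach (m j).reach ≤ V + ε / 2 := by
    rw [payoff_congr (r₂ := fun z => ∑ p, w p * p.toBehavior.reach z) (r₂' := (m j).reach) hw
      (fun _ _ => rfl), payoff_sum_left]
    calc ∑ p, w p * G.payoff i p.toBehavior.reach (m j).reach ≤ ∑ p, w p * (V + ε / 2) :=
          Finset.sum_le_sum fun p _ => mul_le_mul_of_nonneg_left (by
            have h1 := (abs_le.1 (hclose j i hij p)).2
            have h2 := hbest i j hij p₀ hp₀ p
            linarith) (hw0 p)
      _ = V + ε / 2 := by rw [← Finset.sum_mul, hw1, one_mul]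
  -- those in the support of `m i` are best responses to `x j`, so they get at least `V - ε / 2`
  have hlower : V - ε / 2 ≤ G.payoff i (m i).reach (m j).reach := by
    rw [payoff_congr (r₂ := fun z => ∑ p, (m i).weight p * p.toBehavior.reach z)
      (r₂' := (m j).reach) (fun z _ => (m i).reach_eq_sum z) (fun _ _ => rfl), payoff_sum_left]
    calc V - ε / 2 = ∑ p, (m i).weight p * (V - ε / 2) := by rw [← Finset.sum_mul, hm1, one_mul]
      _ ≤ ∑ p, (m i).weight p * G.payoff i p.toBehavior.reach (m j).reach :=
          Finset.sum_le_sum fun p _ => by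
            rcases ((m i).weight_nonneg p).eq_or_lt with h0 | h0
            · rw [← h0]; simp
            · refine mul_le_mul_of_nonneg_left ?_ h0.le
              have h1 := (abs_le.1 (hclose j i hij p)).1
              have h2 := hbest i j hij p (hsupp i p h0) p₀
              linarith
  rw [value_eq_payoff hij, value_eq_payoff hij, Function.update_self,
    Function.update_of_ne hji, payoff_congr (fun _ _ => rfl) (hs j), payoff_congr (hs i) (hs j)]
  linarith

/-- If strategies cannot affect the payoffs, any pure profile is an equilibrium. -/
theorem exists_isNash_pure {ε : ℝ} (hε : 0 < ε)
    (hconst : ∀ i (s s' : ∀ i, G.BehaviorStrategy i), G.value s i = G.value s' i) :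
    ∃ s : ∀ i, G.BehaviorStrategy i, G.IsNash ε s ∧
      ∀ i, ∃ m : G.MixedStrategy i, G.RealizationEquivalent (s i) m ∧
        m.weight.support.card ≤ 1 := by
  let p : ∀ i, G.PureStrategy i := fun i => Classical.arbitrary _
  refine ⟨fun i => (p i).toBehavior, fun i t => ?_, fun i => ?_⟩
  · rw [hconst i _ fun i => (p i).toBehavior]
    linarith
  · obtain ⟨m, hm1, -, hm⟩ := MixedStrategy.exists_uniform one_pos (fun _ : Fin 1 => p i)
    refine ⟨m, fun h _ => ?_, hm1⟩
    rw [m.reach_eq_sum, hm]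
    simp

end TwoPlayers

end ExtensiveGame

theorem mainTheorem6 :
    ∃ C : ℝ, 0 < C ∧
      ∀ (Act Info : Type*) (G : ExtensiveGame (Fin 2) Act Info), G.PerfectRecall →
      ∀ M : ℝ, (∀ i, ∀ z ∈ G.terminals, |G.utility i z| ≤ M) →
      ∀ D : ℕ, IsGreatest
        {d : ℕ | ∃ (i : Fin 2) (p : G.PureStrategy i), d = (G.supportSequences p).ncard} D →
      ∀ ε : ℝ, 0 < ε →
        ∃ s : ∀ i, G.BehaviorStrategy i, G.IsNash ε s ∧
          ∀ i, ∃ m : G.MixedStrategy i, G.RealizationEquivalent (s i) m ∧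
            (m.weight.support.card : ℝ) ≤
              max 1 (C * (M ^ 2 * (D : ℝ) ^ 2 / ε ^ 2) * Real.log (G.nodes.card : ℝ)) := by
  refine ⟨128, by norm_num, fun Act Info G hG M hM D hD ε hε => ?_⟩
  have htriv : (∀ i (s s' : ∀ i, G.BehaviorStrategy i), G.value s i = G.value s' i) →
      ∃ s : ∀ i, G.BehaviorStrategy i, G.IsNash ε s ∧
        ∀ i, ∃ m : G.MixedStrategy i, G.RealizationEquivalent (s i) m ∧
          (m.weight.support.card : ℝ) ≤
            max 1 (128 * (M ^ 2 * (D : ℝ) ^ 2 / ε ^ 2) * Real.log (G.nodes.card : ℝ)) := by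
    intro hconst
    obtain ⟨s, hs, hm⟩ := ExtensiveGame.exists_isNash_pure hε hconst
    refine ⟨s, hs, fun i => ?_⟩
    obtain ⟨m, h1, h2⟩ := hm i
    exact ⟨m, h1, le_max_of_le_left (by exact_mod_cast h2)⟩
  -- for `M ≤ 0` all payoffs vanish
  rcases le_or_gt M 0 with hM0 | hM0
  · refine htriv fun i s s' => Finset.sum_congr rfl fun z hz => ?_
    rw [abs_nonpos_iff.1 ((hM i z hz).trans hM0), mul_zero, mul_zero]
  rcases Nat.lt_or_ge G.nodes.card 2 with hN | hN
  · -- the root is the only node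
    refine htriv fun i s s' => Finset.sum_congr rfl fun z hz => ?_
    have hz : z = [] := Finset.card_le_one.1 (by omega) z
      (ExtensiveGame.mem_nodes_of_mem_terminals hz) [] G.root_mem
    subst hz
    simp [ExtensiveGame.BehaviorStrategy.reach]
  have hD0 : 0 < D := by
    obtain ⟨i, p, rfl⟩ := hD.1
    exact (Set.ncard_pos (ExtensiveGame.finite_supportSequences p)).2
      (ExtensiveGame.supportSequences_nonempty p)
  have hlog : Real.log (2 * G.nodes.card) ≤ 2 * Real.log G.nodes.card := by
    have h2 : (2 : ℝ) ≤ G.nodes.card := by exact_mod_cast hN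
    rw [Real.log_mul (by norm_num) (by positivity)]
    linarith [Real.log_le_log (by norm_num) h2]
  -- `64` is `32` from the sampling lemma times `2` from `log (2 N) ≤ 2 log N`; rounding up to a
  -- positive integer costs another factor `2`
  set y : ℝ := 64 * (M ^ 2 * (D : ℝ) ^ 2 / ε ^ 2) * Real.log (G.nodes.card : ℝ) with hy
  have hceil : ((max 1 ⌈y⌉₊ : ℕ) : ℝ) ≤ max 1 (2 * y) := by
    rcases le_or_gt y 1 with h | h
    · have : max 1 ⌈y⌉₊ = 1 := max_eq_left (Nat.ceil_le.2 (by simpa using h))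
      rw [this]
      simp
    · rw [Nat.cast_max, Nat.cast_one]
      exact max_le_max le_rfl (by linarith [Nat.ceil_lt_add_one (by linarith : 0 ≤ y)])
  obtain ⟨s, hs, hm⟩ := hG.exists_isNash_sparse hM0 hM hε hD0 (fun i p => hD.2 ⟨i, p, rfl⟩)
    (k := max 1 ⌈y⌉₊) (by simp) (by
      calc 32 * M ^ 2 * (D : ℝ) ^ 2 / ε ^ 2 * Real.log (2 * G.nodes.card)
          ≤ 32 * M ^ 2 * (D : ℝ) ^ 2 / ε ^ 2 * (2 * Real.log G.nodes.card) :=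
            mul_le_mul_of_nonneg_left hlog (by positivity)
        _ = y := by rw [hy]; ring
        _ ≤ ⌈y⌉₊ := Nat.le_ceil y
        _ ≤ _ := by exact_mod_cast le_max_right _ _)
  refine ⟨s, hs, fun i => ?_⟩
  obtain ⟨m, h1, h2⟩ := hm i
  refine ⟨m, h1, le_trans (by exact_mod_cast h2) (hceil.trans_eq ?_)⟩
  rw [hy]
  congr 1
  ring
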